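/- Let $n$ and $r$ be positive integers, and let $\mathrm{GL}_n(\mathbb{C})$ act on $\mathfrak{gl}_n(\mathbb{C})$ by conjugation; the orbits are called adjoint orbits. Order them by the closure order: $\mathcal{O}\preceq\mathcal{O}'$ if and only if $\mathcal{O}\subseteq\overline{\mathcal{O}'}$ (Zariski closure). Let $$V^r=\{(x_{ij})\in\mathfrak{gl}_n(\mathbb{C})\mid x_{ij}=0\text{ if } i-j>r,\ \text{and } x_{ij}\neq 0\text{ if } i-j=r\}$$ be the set of matrices with zeros below, and nonzero entries on, the $r$th subdiagonal. For a positive integer $m$, write $m=kr+r'$ with integers $k\ge 0$ and $0\le r'<r$, and let $\lambda^{r,m}$ be the partition of $m$ with $r'$ parts equal to $k+1$ and $r-r'$ parts equal to $k$ (parts equal to $0$ are discarded). For a monic polynomial $q=\prod_{i=1}^s(x-a_i)^{m_i}\in\mathbb{C}[x]$ of degree $n$, with $a_1,\dots,a_s$ distinct and all $m_i>0$, let $\mathcal{O}^r_q$ be the adjoint orbit of matrices with characteristic polynomial $q$ whose Jordan blocks with eigenvalue $a_i$ have as sizes the parts of $\lambda^{r,m_i}$, for $i=1,\dots,s$. Then: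 1. An adjoint orbit in $\mathfrak{gl}_n(\mathbb{C})$ intersects $V^r$ if and only if its elements have at most $r$ Jordan blocks for each eigenvalue. 2. The minimal elements, with respect to $\preceq$, of the set of adjoint orbits that intersect $V^r$ are precisely the orbits $\mathcal{O}^r_q$, where $q$ runs over the monic polynomials of degree $n$. -/

import Mathlib

open Polynomial

/-- The adjoint orbits of `GL_n(ℂ)` in `gl_n(ℂ)`, i.e. the similarity classes of complex
`n × n` matrices; `GL_n(ℂ)` acts by `g • X = g X g⁻¹`. -/
abbrev AdjointOrbit (n : ℕ) : Type :=
  MulAction.orbitRel.Quotient (ConjAct (GL (Fin n) ℂ)) (Matrix (Fin n) (Fin n) ℂ)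

/-- The adjoint orbit of a matrix. -/
def adjointOrbitOf {n : ℕ} (X : Matrix (Fin n) (Fin n) ℂ) : AdjointOrbit n :=
  Quotient.mk'' X

/-- The Zariski closure of a set of matrices, inside the affine space `gl_n(ℂ)`. -/
def zariskiClosure {n : ℕ} (S : Set (Matrix (Fin n) (Fin n) ℂ)) :
    Set (Matrix (Fin n) (Fin n) ℂ) :=
  {X | ∀ p : MvPolynomial (Fin n × Fin n) ℂ,
    (∀ Y ∈ S, MvPolynomial.eval (fun ij => Y ij.1 ij.2) p = 0) →
      MvPolynomial.eval (fun ij => X ij.1 ij.2) p = 0}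

/-- The closure order on adjoint orbits: `O ≼ O'` iff `O` lies in the closure of `O'`. -/
def AdjointOrbit.ClosureLE {n : ℕ} (O O' : AdjointOrbit n) : Prop :=
  O.orbit ⊆ zariskiClosure O'.orbit

/-- The minimal elements, for the closure order, of a set of adjoint orbits. -/
def minimalOrbits {n : ℕ} (S : Set (AdjointOrbit n)) : Set (AdjointOrbit n) :=
  {O | O ∈ S ∧ ∀ O' ∈ S, O'.ClosureLE O → O' = O}

/-- The matrices with zeros below, and nonzero entries on, the `r`-th subdiagonal. -/
def subdiagonalSet (n r : ℕ) : Set (Matrix (Fin n) (Fin n) ℂ) :=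
  {X | ∀ i j : Fin n,
    ((j : ℕ) + r < (i : ℕ) → X i j = 0) ∧ ((i : ℕ) = (j : ℕ) + r → X i j ≠ 0)}

/-- The adjoint orbits that meet `subdiagonalSet n r`. -/
def orbitsMeeting (n r : ℕ) : Set (AdjointOrbit n) :=
  {O | (O.orbit ∩ subdiagonalSet n r).Nonempty}

/-- The Jordan block of size `k` with eigenvalue `a`. -/
def jordanBlock (a : ℂ) (k : ℕ) : Matrix (Fin k) (Fin k) ℂ :=
  Matrix.of fun i j => if i = j then a else if (i : ℕ) + 1 = (j : ℕ) then 1 else 0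

/-- The `j`-th part of a partition, the parts being listed in nonincreasing order. -/
def partAt {m : ℕ} (lam : Nat.Partition m) (j : Fin (lam.parts.sort (· ≥ ·)).length) : ℕ :=
  (lam.parts.sort (· ≥ ·)).get j

/-- A choice, for every `a`, of a partition of the multiplicity of `a` as a root of `q`.
When `a` is not a root of `q` there is only the empty partition of `0` to choose. -/
abbrev JordanData (q : ℂ[X]) : Type :=
  (a : ℂ) → Nat.Partition (q.rootMultiplicity a)

/-- The Jordan blocks prescribed by `L`: pairs of a root `a` of `q` and (the position of) a part
of the partition `L a`. -/
abbrev JordanBlockIndex {q : ℂ[X]} (L : JordanData q) : Type :=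
  (a : {a : ℂ // a ∈ q.roots.toFinset}) × Fin ((L a).parts.sort (· ≥ ·)).length

/-- The total size of the Jordan blocks prescribed by `L` is the degree of `q`. -/
theorem card_jordanIndex {q : ℂ[X]} (L : JordanData q) :
    Fintype.card ((b : JordanBlockIndex L) × Fin (partAt (L b.1) b.2)) = q.natDegree := by
  have hpart : ∀ {m : ℕ} (lam : Nat.Partition m), ∑ j, partAt lam j = m := by
    intro m lam
    have h : ∑ j, partAt lam j = (lam.parts.sort (· ≥ ·)).sum := by
      rw [← List.sum_ofFn]
      congr 1
      exact List.ofFn_get _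
    rw [h, ← Multiset.sum_coe, Multiset.sort_eq, lam.parts_sum]
  rw [Fintype.card_sigma]
  simp only [Fintype.card_fin]
  rw [Fintype.sum_sigma]
  simp only [hpart]
  rw [Finset.sum_coe_sort q.roots.toFinset (fun a => q.rootMultiplicity a)]
  simp only [← Polynomial.count_roots]
  rw [Multiset.toFinset_sum_count_eq]
  exact (IsAlgClosed.splits q).natDegree_eq_card_roots.symm

/-- The monic complex polynomials of degree `n`. -/
abbrev MonicPoly (n : ℕ) : Type := {q : ℂ[X] // q.Monic ∧ q.natDegree = n}

/-- The block diagonal matrix in Jordan form with characteristic polynomial `q` whose Jordan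
blocks with eigenvalue `a` have the parts of `L a` as their sizes. The rows and columns are
numbered by `Fin n` in an arbitrary way, which does not affect the orbit. -/
noncomputable def jordanMatrix {n : ℕ} (q : MonicPoly n) (L : JordanData q.1) :
    Matrix (Fin n) (Fin n) ℂ :=
  let e := Fintype.equivFinOfCardEq ((card_jordanIndex L).trans q.2.2)
  Matrix.reindex e e
    (Matrix.blockDiagonal' fun b : JordanBlockIndex L => jordanBlock b.1.1 (partAt (L b.1) b.2))

/-- The adjoint orbit with characteristic polynomial `q` and Jordan block sizes given by `L`. -/
noncomputable def jordanOrbit {n : ℕ} (q : MonicPoly n) (L : JordanData q.1) : AdjointOrbit n :=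
  adjointOrbitOf (jordanMatrix q L)

/-- The orbits with characteristic polynomial `q` that have at most `r` Jordan blocks for each
eigenvalue. -/
def filterOfPoly {n : ℕ} (r : ℕ) (q : MonicPoly n) : Set (AdjointOrbit n) :=
  {O | ∃ L : JordanData q.1, (∀ a, (L a).parts.card ≤ r) ∧ O = jordanOrbit q L}

/-- The orbits with at most `r` Jordan blocks for each eigenvalue. -/
def orbitFilter (n r : ℕ) : Set (AdjointOrbit n) :=
  ⋃ q : MonicPoly n, filterOfPoly r q

/-- For `r > 0` and `m = k r + r'` with `0 ≤ r' < r`, the partition of `m` with `r'` parts equal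
to `k + 1` and `r - r'` parts equal to `k` (where parts equal to `0` are discarded). -/
def balancedPartition (r m : ℕ) : Nat.Partition m :=
  Nat.Partition.ofSums m
    (Multiset.replicate (m % r) (m / r + 1) + Multiset.replicate (r - m % r) (m / r)) (by
      rcases Nat.eq_zero_or_pos r with rfl | hr
      · simp
      · obtain ⟨c, hc⟩ := Nat.exists_eq_add_of_le (Nat.mod_lt m hr).le
        have h1 : r - m % r = c := by omega
        have h2 := Nat.div_add_mod m r
        simp only [Multiset.sum_add, Multiset.sum_replicate, smul_eq_mul, h1]
        calc m % r * (m / r + 1) + c * (m / r) = (m % r + c) * (m / r) + m % r := by ring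
          _ = m := by rw [← hc]; exact h2)

/-- The orbit with characteristic polynomial `q` such that, for each root `a` of `q` with
multiplicity `m`, the sizes of the Jordan blocks with eigenvalue `a` form
`balancedPartition r m`. -/
noncomputable def balancedOrbit {n : ℕ} (r : ℕ) (q : MonicPoly n) : AdjointOrbit n :=
  jordanOrbit q fun a => balancedPartition r (q.1.rootMultiplicity a)

/-! The proof runs on the numbers rank `(X - a)^k`, which determine the similarity class: their
second differences in `k` count the Jordan blocks of each size (`similar_of_rank_eq`).

If `X` lies in `V^r`, then so does `X - a`, and `(X - a)^k` has its last nonzero subdiagonal in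
position `r * k`; hence rank `(X - a)^k ≥ n - r * k`. For `k = 1` this bounds the number of blocks
by `r`. If moreover rank `(X - a)^k ≤ n - min (m_a) (r * k)` for all `a` and `k`, with `m_a` the
multiplicities of `q`, then a dimension count forces equality and `X` lies in the balanced orbit of
`q` (`adjointOrbitOf_eq_balancedOrbit`). This rigidity is used twice: an explicit bidiagonal matrix
shows that balanced orbits meet `V^r`, and semicontinuity of rank shows that nothing meeting `V^r`
lies strictly below a balanced orbit.

For the remaining inclusion, meeting `V^r` is the nonvanishing, somewhere on the orbit, of one
polynomial, the determinant of `krylovMatrix`. The condition therefore passes to larger orbits in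
the closure order. An orbit with at most `r` blocks per eigenvalue degenerates to the balanced one
by repeatedly moving a unit from a long block to a shorter one with the same eigenvalue
(`balancedOrbit_closureLE`), so it too meets `V^r`, and only balanced orbits can be minimal. -/

/-! ### Similarity and adjoint orbits. -/

/-- Similarity of square complex matrices whose index types may differ. -/
def MatrixSimilar {ι κ : Type*} [Fintype ι] [Fintype κ] [DecidableEq ι] [DecidableEq κ]
    (A : Matrix ι ι ℂ) (B : Matrix κ κ ℂ) : Prop :=
  ∃ (P : Matrix ι κ ℂ) (Q : Matrix κ ι ℂ), P * Q = 1 ∧ Q * P = 1 ∧ A * P = P * B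

namespace MatrixSimilar

variable {ι κ ν : Type*} [Fintype ι] [Fintype κ] [Fintype ν]
  [DecidableEq ι] [DecidableEq κ] [DecidableEq ν]
  {A : Matrix ι ι ℂ} {B : Matrix κ κ ℂ} {C : Matrix ν ν ℂ}

theorem refl (A : Matrix ι ι ℂ) : MatrixSimilar A A :=
  ⟨1, 1, by simp, by simp, by simp⟩

theorem symm (h : MatrixSimilar A B) : MatrixSimilar B A := by
  obtain ⟨P, Q, hPQ, hQP, h⟩ := h
  refine ⟨Q, P, hQP, hPQ, ?_⟩
  calc B * Q = Q * P * B * Q := by rw [hQP, Matrix.one_mul]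
    _ = Q * (A * P) * Q := by rw [h, Matrix.mul_assoc Q P B]
    _ = Q * A * (P * Q) := by simp only [Matrix.mul_assoc]
    _ = Q * A := by rw [hPQ, Matrix.mul_one]

theorem trans (h : MatrixSimilar A B) (h' : MatrixSimilar B C) : MatrixSimilar A C := by
  obtain ⟨P, Q, hPQ, hQP, h⟩ := h
  obtain ⟨P', Q', hPQ', hQP', h'⟩ := h'
  refine ⟨P * P', Q' * Q, ?_, ?_, ?_⟩
  · rw [Matrix.mul_assoc, ← Matrix.mul_assoc P', hPQ', Matrix.one_mul, hPQ]
  · rw [Matrix.mul_assoc, ← Matrix.mul_assoc Q, hQP, Matrix.one_mul, hQP']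
  · rw [← Matrix.mul_assoc, h, Matrix.mul_assoc, h', Matrix.mul_assoc]

theorem submatrix_equiv (A : Matrix ι ι ℂ) (e : κ ≃ ι) : MatrixSimilar (A.submatrix e e) A := by
  refine ⟨(1 : Matrix ι ι ℂ).submatrix e id, (1 : Matrix ι ι ℂ).submatrix id e, ?_, ?_, ?_⟩
  · rw [← Matrix.submatrix_mul _ _ _ _ _ Function.bijective_id]; simp
  · rw [← Matrix.submatrix_mul _ _ _ _ _ e.bijective]; simp
  · rw [← Matrix.submatrix_mul _ _ _ _ _ e.bijective]
    nth_rw 2 [← Matrix.submatrix_id_id A]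
    rw [← Matrix.submatrix_mul _ _ _ _ _ Function.bijective_id]; simp

theorem reindex (A : Matrix ι ι ℂ) (e : ι ≃ κ) : MatrixSimilar (Matrix.reindex e e A) A :=
  submatrix_equiv A e.symm

theorem sub_smul_one (h : MatrixSimilar A B) (a : ℂ) :
    MatrixSimilar (A - a • (1 : Matrix ι ι ℂ)) (B - a • (1 : Matrix κ κ ℂ)) := by
  obtain ⟨P, Q, hPQ, hQP, h⟩ := h
  exact ⟨P, Q, hPQ, hQP, by simp [Matrix.sub_mul, Matrix.mul_sub, h]⟩

theorem pow (h : MatrixSimilar A B) (k : ℕ) : MatrixSimilar (A ^ k) (B ^ k) := by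
  obtain ⟨P, Q, hPQ, hQP, h⟩ := h
  refine ⟨P, Q, hPQ, hQP, ?_⟩
  induction k with
  | zero => simp
  | succ k ih => rw [pow_succ, Matrix.mul_assoc, h, ← Matrix.mul_assoc, ih, pow_succ,
      Matrix.mul_assoc]

theorem rank_le (h : MatrixSimilar A B) : A.rank ≤ B.rank := by
  obtain ⟨P, Q, hPQ, hQP, h⟩ := h
  have : A = P * B * Q := by rw [← h, Matrix.mul_assoc, hPQ, Matrix.mul_one]
  rw [this]
  exact (Matrix.rank_mul_le_left _ _).trans (Matrix.rank_mul_le_right _ _)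

theorem rank_eq (h : MatrixSimilar A B) : A.rank = B.rank :=
  le_antisymm h.rank_le h.symm.rank_le

theorem rank_sub_pow (h : MatrixSimilar A B) (a : ℂ) (k : ℕ) :
    ((A - a • (1 : Matrix ι ι ℂ)) ^ k).rank = ((B - a • (1 : Matrix κ κ ℂ)) ^ k).rank :=
  ((h.sub_smul_one a).pow k).rank_eq

theorem card_eq (h : MatrixSimilar A B) : Fintype.card ι = Fintype.card κ := by
  have := h.rank_sub_pow 0 0
  simpa using this

end MatrixSimilar

theorem adjointOrbitOf_eq_iff {n : ℕ} {X Y : Matrix (Fin n) (Fin n) ℂ} :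
    adjointOrbitOf X = adjointOrbitOf Y ↔ MatrixSimilar X Y := by
  unfold adjointOrbitOf
  rw [Quotient.eq'']
  change X ∈ MulAction.orbit _ Y ↔ _
  constructor
  · rintro ⟨g, rfl⟩
    refine ⟨(ConjAct.ofConjAct g : GL (Fin n) ℂ), ((ConjAct.ofConjAct g)⁻¹ : GL (Fin n) ℂ),
      Units.mul_inv _, Units.inv_mul _, ?_⟩
    simp [ConjAct.units_smul_def, Matrix.mul_assoc]
  · rintro ⟨P, Q, hPQ, hQP, h⟩
    refine ⟨ConjAct.toConjAct (⟨P, Q, hPQ, hQP⟩ : GL (Fin n) ℂ), ?_⟩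
    change P * Y * Q = X
    rw [← h, Matrix.mul_assoc, hPQ, Matrix.mul_one]

theorem mem_orbit_adjointOrbitOf {n : ℕ} {X Y : Matrix (Fin n) (Fin n) ℂ} :
    Y ∈ (adjointOrbitOf X).orbit ↔ MatrixSimilar Y X := by
  rw [MulAction.orbitRel.Quotient.mem_orbit]
  exact adjointOrbitOf_eq_iff

theorem exists_adjointOrbitOf_eq {n : ℕ} (O : AdjointOrbit n) : ∃ X, O = adjointOrbitOf X := by
  induction O using Quotient.inductionOn' with
  | h X => exact ⟨X, rfl⟩

/-! ### Sums of Jordan blocks and the ranks of their powers. -/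

/-- The block diagonal matrix of Jordan blocks with eigenvalues `d i` and sizes `s i`. -/
noncomputable def jordanSum {ι : Type*} [DecidableEq ι] (d : ι → ℂ) (s : ι → ℕ) :
    Matrix ((i : ι) × Fin (s i)) ((i : ι) × Fin (s i)) ℂ :=
  Matrix.blockDiagonal' fun i => jordanBlock (d i) (s i)

/-- Invertible row and column operations make each block diagonal; assembled blockwise they stay
invertible, and the rank becomes a count of nonzero diagonal entries. -/
theorem rank_blockDiagonal' {ι : Type*} [Fintype ι] [DecidableEq ι] {m : ι → Type*}
    [∀ i, Fintype (m i)] [∀ i, DecidableEq (m i)] (M : ∀ i, Matrix (m i) (m i) ℂ) :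
    (Matrix.blockDiagonal' M).rank = ∑ i, (M i).rank := by
  classical
  have key : ∀ i, ∃ (V U : Matrix (m i) (m i) ℂ) (D : m i → ℂ),
      IsUnit V ∧ IsUnit U ∧ V * M i * U = Matrix.diagonal D := by
    intro i
    obtain ⟨V, U, e, hV, hU, h⟩ := Matrix.exists_rank_normal_form (M i)
    refine ⟨V, U, fun x => Sum.elim (fun _ => 1) (fun _ => 0) (e x), hV, hU, ?_⟩
    rw [h]
    have : (Matrix.fromBlocks 1 0 0 0 : Matrix (Fin (M i).rank ⊕ _)
        (Fin (M i).rank ⊕ Fin (Fintype.card (m i) - (M i).rank)) ℂ) =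
        Matrix.diagonal (Sum.elim (fun _ => 1) (fun _ => 0)) := by
      ext a b
      rcases a with a | a <;> rcases b with b | b <;> simp [Matrix.diagonal, Matrix.one_apply]
    rw [this, Matrix.submatrix_diagonal_equiv]
    rfl
  choose V U D hV hU h using key
  have hunit : ∀ W : ∀ i, Matrix (m i) (m i) ℂ, (∀ i, IsUnit (W i)) →
      IsUnit (Matrix.blockDiagonal' W).det := by
    intro W hW
    exact (Matrix.isUnit_iff_isUnit_det _).1
      ((Pi.isUnit_iff.2 hW).map (Matrix.blockDiagonal'RingHom m ℂ))
  have h1 : (Matrix.blockDiagonal' V * Matrix.blockDiagonal' M * Matrix.blockDiagonal' U) =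
      Matrix.diagonal fun x : (i : ι) × m i => D x.1 x.2 := by
    rw [← Matrix.blockDiagonal'_mul, ← Matrix.blockDiagonal'_mul]
    simp_rw [h]
    exact Matrix.blockDiagonal'_diagonal D
  have h2 : (Matrix.blockDiagonal' M).rank =
      (Matrix.diagonal fun x : (i : ι) × m i => D x.1 x.2).rank := by
    rw [← h1, Matrix.rank_mul_eq_left_of_isUnit_det _ _ (hunit U hU),
      Matrix.rank_mul_eq_right_of_isUnit_det _ _ (hunit V hV)]
  have h3 : ∀ i, (M i).rank = Fintype.card {x // D i x ≠ 0} := by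
    intro i
    rw [← Matrix.rank_diagonal, ← h, Matrix.rank_mul_eq_left_of_isUnit_det _ _
      ((Matrix.isUnit_iff_isUnit_det _).1 (hU i)), Matrix.rank_mul_eq_right_of_isUnit_det _ _
      ((Matrix.isUnit_iff_isUnit_det _).1 (hV i))]
  rw [h2, Matrix.rank_diagonal]
  simp_rw [h3]
  rw [← Fintype.card_sigma]
  refine Fintype.card_congr ⟨fun x => ⟨x.1.1, x.1.2, x.2⟩, fun x => ⟨⟨x.1, x.2.1⟩, x.2.2⟩,
    fun _ => rfl, fun _ => rfl⟩

theorem jordanBlock_sub_smul_one (a b : ℂ) (s : ℕ) :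
    jordanBlock a s - b • (1 : Matrix (Fin s) (Fin s) ℂ) = jordanBlock (a - b) s := by
  ext i j
  by_cases h : i = j <;> simp [jordanBlock, h]

theorem jordanBlock_zero_pow_apply (s k : ℕ) (i j : Fin s) :
    (jordanBlock 0 s ^ k) i j = if (i : ℕ) + k = j then 1 else 0 := by
  induction k generalizing i j with
  | zero => simp [Matrix.one_apply, Fin.ext_iff]
  | succ k ih =>
    rw [pow_succ', Matrix.mul_apply]
    simp_rw [ih]
    by_cases h : (i : ℕ) + 1 < s
    · rw [Finset.sum_eq_single ⟨i + 1, h⟩]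
      · simp [jordanBlock, Fin.ext_iff, show (i : ℕ) + 1 + k = i + (k + 1) by omega]
      · intro b _ hb
        have : (i : ℕ) + 1 ≠ b := fun h' => hb (Fin.ext h'.symm)
        simp [jordanBlock, this]
      · simp
    · rw [if_neg (by omega)]
      refine Finset.sum_eq_zero fun b _ => ?_
      have : (i : ℕ) + 1 ≠ b := by omega
      simp [jordanBlock, this]

theorem rank_jordanBlock_pow (a : ℂ) (s k : ℕ) :
    (jordanBlock a s ^ k).rank = if a = 0 then s - k else s := by
  split_ifs with h
  · subst h
    apply le_antisymm
    · refine (Matrix.rank_le_card_of_support_subset _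
        (Finset.univ.filter fun i : Fin s => (i : ℕ) < s - k) ?_).trans ?_
      · intro i hi
        simp only [Finset.coe_filter, Finset.mem_univ, true_and, Set.mem_ofPred_eq]
        by_contra h'
        apply hi
        ext j
        rw [Matrix.row_apply, jordanBlock_zero_pow_apply, if_neg (by omega)]
        rfl
      · rw [Fin.card_filter_val_lt]; omega
    -- Deleting the last `k` rows and the first `k` columns leaves an identity matrix.
    · have := Matrix.rank_submatrix_le (jordanBlock 0 s ^ k)
        (fun i : Fin (s - k) => (⟨i, by omega⟩ : Fin s)) (fun i : Fin (s - k) => ⟨i + k, by omega⟩)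
      refine le_trans ?_ this
      have h1 : (jordanBlock 0 s ^ k).submatrix (fun i : Fin (s - k) => (⟨i, by omega⟩ : Fin s))
          (fun i : Fin (s - k) => ⟨i + k, by omega⟩) = 1 := by
        ext i j
        rw [Matrix.submatrix_apply, jordanBlock_zero_pow_apply]
        simp [Matrix.one_apply, Fin.ext_iff]
      rw [h1, Matrix.rank_one, Fintype.card_fin]
  · rw [Matrix.rank_of_det_ne_zero, Fintype.card_fin]
    rw [Matrix.det_pow, Matrix.det_of_isUpperTriangular]
    · simp [jordanBlock, h]
    · intro i j hij
      simp only [id] at hij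
      have h1 : (j : ℕ) < i := hij
      have h2 : i ≠ j := by rintro rfl; omega
      simp [jordanBlock, h2]; omega

theorem rank_jordanSum_sub_pow {ι : Type*} [Fintype ι] [DecidableEq ι] (d : ι → ℂ) (s : ι → ℕ)
    (a : ℂ) (k : ℕ) :
    ((jordanSum d s - a • (1 : Matrix ((i : ι) × Fin (s i)) _ ℂ)) ^ k).rank =
      ∑ i, if d i = a then s i - k else s i := by
  have h : jordanSum d s - a • (1 : Matrix ((i : ι) × Fin (s i)) _ ℂ) =
      Matrix.blockDiagonal' fun i => jordanBlock (d i - a) (s i) := by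
    rw [← Matrix.blockDiagonal'_one, ← Matrix.blockDiagonal'_smul, jordanSum,
      ← Matrix.blockDiagonal'_sub]
    congr 1
    funext i
    exact jordanBlock_sub_smul_one _ _ _
  rw [h, ← Matrix.blockDiagonal'_pow, rank_blockDiagonal']
  refine Finset.sum_congr rfl fun i _ => ?_
  simp only [Pi.pow_apply, rank_jordanBlock_pow, sub_eq_zero]

theorem jordanSum_apply {ι : Type*} [DecidableEq ι] (d : ι → ℂ) (s : ι → ℕ)
    (x y : (i : ι) × Fin (s i)) :
    jordanSum d s x y = if x.1 = y.1 then
      (if (x.2 : ℕ) = y.2 then d x.1 else if (x.2 : ℕ) + 1 = y.2 then 1 else 0) else 0 := by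
  obtain ⟨i, j⟩ := x
  obtain ⟨i', j'⟩ := y
  by_cases h : i = i'
  · subst h
    simp [jordanSum, Matrix.blockDiagonal'_apply, jordanBlock, Fin.ext_iff]
  · simp [jordanSum, Matrix.blockDiagonal'_apply, h]

/-! ### Existence and uniqueness of the Jordan form. -/

/-- Blocks of size 0 contribute no rows, so they can be inserted or dropped freely; this later
allows padding to exactly `r` blocks per eigenvalue. -/
theorem MatrixSimilar.jordanSum_of_injective {ι ι' : Type*} [Fintype ι] [DecidableEq ι]
    [Fintype ι'] [DecidableEq ι'] {d : ι → ℂ} {s : ι → ℕ} {d' : ι' → ℂ} {s' : ι' → ℕ}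
    (e : ι → ι') (he : Function.Injective e) (hd : ∀ i, d' (e i) = d i) (hs : ∀ i, s' (e i) = s i)
    (h0 : ∀ i', i' ∉ Set.range e → s' i' = 0) :
    MatrixSimilar (jordanSum d s) (jordanSum d' s') := by
  let g : ((i : ι) × Fin (s i)) → ((i : ι') × Fin (s' i)) :=
    fun x => ⟨e x.1, Fin.cast (hs x.1).symm x.2⟩
  have hg : Function.Bijective g := by
    constructor
    · rintro ⟨i, j⟩ ⟨i', j'⟩ h
      have h1 : e i = e i' := congrArg Sigma.fst h
      obtain rfl := he h1
      have h2 := eq_of_heq (Sigma.mk.inj h).2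
      have h3 : (j : ℕ) = j' := by simpa using congrArg Fin.val h2
      rw [Fin.ext h3]
    · rintro ⟨i', j'⟩
      by_cases h : i' ∈ Set.range e
      · obtain ⟨i, rfl⟩ := h
        exact ⟨⟨i, Fin.cast (hs i) j'⟩, rfl⟩
      · have := h0 i' h
        exact absurd j'.2 (by omega)
  have h : jordanSum d s = (jordanSum d' s').submatrix (Equiv.ofBijective g hg)
      (Equiv.ofBijective g hg) := by
    ext x y
    rw [Matrix.submatrix_apply, jordanSum_apply, jordanSum_apply]
    change _ = if e x.1 = e y.1 then
      (if (x.2 : ℕ) = y.2 then d' (e x.1) else if (x.2 : ℕ) + 1 = y.2 then 1 else 0) else 0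
    by_cases h : x.1 = y.1 <;> simp [he.eq_iff, hd, h]
  rw [h]
  exact submatrix_equiv _ _

/-- The matrix whose columns are the chain vectors intertwines the two sides. Spanning gives it a
right inverse, which is two-sided because it is square by `hcard`. -/
theorem MatrixSimilar.jordanSum_of_chains {ι κ : Type*} [Fintype ι] [DecidableEq ι]
    [Fintype κ] [DecidableEq κ] (A : Matrix κ κ ℂ) (d : ι → ℂ) (s : ι → ℕ) (v : ι → ℕ → κ → ℂ)
    (h0 : ∀ i, 0 < s i → A.mulVec (v i 0) = d i • v i 0)
    (h1 : ∀ i j, j + 1 < s i → A.mulVec (v i (j + 1)) = d i • v i (j + 1) + v i j)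
    (hspan : ∀ S : Submodule ℂ (κ → ℂ), (∀ i j, j < s i → v i j ∈ S) → S = ⊤)
    (hcard : Fintype.card κ = ∑ i, s i) : MatrixSimilar A (jordanSum d s) := by
  let P : Matrix κ ((i : ι) × Fin (s i)) ℂ := Matrix.of fun x y => v y.1 y.2 x
  have hsurj : LinearMap.range P.mulVecLin = ⊤ := by
    refine hspan _ fun i j hj => ⟨Pi.single ⟨i, j, hj⟩ 1, ?_⟩
    rw [Matrix.mulVecLin_apply, Matrix.mulVec_single_one]
    rfl
  rw [LinearMap.range_eq_top] at hsurj
  choose w hw using fun k : κ => hsurj (Pi.single k 1)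
  have hPQ : P * (Matrix.of fun y k => w k y) = 1 := by
    ext x k
    have := congrFun (hw k) x
    rw [Matrix.mulVecLin_apply] at this
    rw [Matrix.one_apply, Matrix.mul_apply]
    simpa [Matrix.mulVec, dotProduct, Pi.single_apply] using this
  refine ⟨P, _, hPQ, (Matrix.mul_eq_one_comm_of_card_eq _ _ _ (by simp [hcard])).1 hPQ, ?_⟩
  ext x ⟨i, j, hj⟩
  have hL : (A * P) x ⟨i, j, hj⟩ = A.mulVec (v i j) x := rfl
  rw [hL, Matrix.mul_apply, Fintype.sum_sigma, Finset.sum_eq_single i _ (by simp)]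
  · simp only [jordanSum_apply, P, Matrix.of_apply, if_true]
    rcases j with _ | j
    · rw [h0 i hj, Finset.sum_eq_single ⟨0, hj⟩ _ (by simp)]
      · simp [mul_comm]
      · intro b _ hb
        have : (b : ℕ) ≠ 0 := fun h => hb (Fin.ext h)
        simp [this]
    · rw [h1 i j hj]
      have hne : (⟨j, by omega⟩ : Fin (s i)) ≠ ⟨j + 1, hj⟩ := by simp
      rw [Finset.sum_eq_add_of_mem ⟨j + 1, hj⟩ ⟨j, by omega⟩ (Finset.mem_univ _)
        (Finset.mem_univ _) hne.symm]
      · simp [mul_comm]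
      · rintro b _ ⟨hb, hb'⟩
        have h2 : (b : ℕ) ≠ j + 1 := fun h => hb (Fin.ext h)
        have h3 : (b : ℕ) ≠ j := fun h => hb' (Fin.ext h)
        simp [h2, h3]
  · intro i' _ hi
    simp [jordanSum_apply, hi]

theorem exists_span_eq_span_X_sub_C_pow {p : ℂ[X]} (hp : Irreducible p) (e : ℕ) :
    ∃ a : ℂ, Ideal.span {p ^ e} = Ideal.span {(X - C a) ^ e} := by
  obtain ⟨a, ha⟩ := IsAlgClosed.exists_root p (by
    rw [IsAlgClosed.degree_eq_one_of_irreducible ℂ hp]; exact one_ne_zero)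
  refine ⟨a, Ideal.span_singleton_eq_span_singleton.2 ?_⟩
  refine Associated.pow_pow ?_
  exact ((irreducible_X_sub_C a).associated_of_dvd hp (dvd_iff_isRoot.2 ha)).symm

-- The structure theorem for torsion modules over `ℂ[X]` splits the space into summands `ℂ[X] / (X -
-- a)^e`, each of which carries one Jordan chain.
open DirectSum in
theorem exists_similar_jordanSum {κ : Type} [Fintype κ] [DecidableEq κ] (A : Matrix κ κ ℂ) :
    ∃ (ι : Type) (_ : Fintype ι) (_ : DecidableEq ι) (d : ι → ℂ) (s : ι → ℕ),
      MatrixSimilar A (jordanSum d s) := by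
  classical
  let f := A.toLin'
  have htor : Module.IsTorsion ℂ[X] (Module.AEval ℂ (κ → ℂ) f) :=
    Module.AEval.isTorsion_of_finiteDimensional ℂ (κ → ℂ) f
  obtain ⟨ι, _, p, hp, e, ⟨φ⟩⟩ := Module.equiv_directSum_of_isTorsion htor
  choose a ha using fun i => exists_span_eq_span_X_sub_C_pow (hp i) (e i)
  let u : ∀ i, ℂ[X] →ₗ[ℂ[X]] Module.AEval ℂ (κ → ℂ) f := fun i =>
    φ.symm.toLinearMap ∘ₗ (DirectSum.lof ℂ[X] ι (fun i => ℂ[X] ⧸ ℂ[X] ∙ p i ^ e i) i) ∘ₗ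
      Submodule.mkQ _
  let o := (Module.AEval.of ℂ (κ → ℂ) f).symm
  have hu0 : ∀ i q, u i (q * (X - C (a i)) ^ e i) = 0 := by
    intro i q
    have : Submodule.mkQ (ℂ[X] ∙ p i ^ e i) (q * (X - C (a i)) ^ e i) = 0 := by
      rw [Submodule.mkQ_apply, Submodule.Quotient.mk_eq_zero]
      change _ ∈ Ideal.span _
      rw [ha i]
      exact Ideal.mul_mem_left _ _ (Ideal.mem_span_singleton_self _)
    simp only [u, LinearMap.comp_apply]
    rw [this, map_zero, map_zero]
  have huX : ∀ i q, A.mulVec (o (u i q)) = o (u i (X * q)) := by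
    intro i q
    rw [← smul_eq_mul X q, map_smul, Module.AEval.of_symm_X_smul]
    rfl
  have huC : ∀ i c q, o (u i (C c * q)) = c • o (u i q) := by
    intro i c q
    rw [← smul_eq_mul, map_smul, Module.AEval.C_smul, map_smul]
  -- The exponents decrease along the chain, so that multiplication by `X - a` lowers the index `j`
  -- and kills the vector at `j = 0`.
  refine ⟨ι, inferInstance, inferInstance, a, e, MatrixSimilar.jordanSum_of_chains A a e
    (fun i j => o (u i ((X - C (a i)) ^ (e i - 1 - j)))) ?_ ?_ ?_ ?_⟩
  · intro i hi
    have : (X * (X - C (a i)) ^ (e i - 1 - 0) : ℂ[X]) =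
        C (a i) * (X - C (a i)) ^ (e i - 1 - 0) + 1 * (X - C (a i)) ^ e i := by
      obtain ⟨m, hm⟩ : ∃ m, e i = m + 1 := ⟨e i - 1, by omega⟩
      simp only [hm, Nat.add_sub_cancel, Nat.sub_zero, pow_succ]
      ring
    rw [huX, this, map_add, hu0, add_zero, huC]
  · intro i j hj
    have : (X * (X - C (a i)) ^ (e i - 1 - (j + 1)) : ℂ[X]) =
        C (a i) * (X - C (a i)) ^ (e i - 1 - (j + 1)) + (X - C (a i)) ^ (e i - 1 - j) := by
      obtain ⟨m, hm⟩ : ∃ m, e i = m + 1 + (j + 1) := ⟨e i - 1 - (j + 1), by omega⟩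
      rw [hm, show m + 1 + (j + 1) - 1 - (j + 1) = m by omega,
        show m + 1 + (j + 1) - 1 - j = m + 1 by omega, pow_succ]
      ring
    rw [huX, this, map_add, map_add, huC]
  · intro S hS
    have h1 : ∀ i q, o (u i q) ∈ S := by
      intro i q
      -- Expand `q` in powers of `X - a`: exponents below `e i` give chain vectors, the others give
      -- zero.
      rw [← sum_taylor_eq q (a i), Polynomial.sum, map_sum, map_sum]
      refine Submodule.sum_mem _ fun m _ => ?_
      rw [huC]
      refine Submodule.smul_mem _ _ ?_
      by_cases hm : m < e i
      · have := hS i (e i - 1 - m) (by omega)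
        rwa [show e i - 1 - (e i - 1 - m) = m by omega] at this
      · obtain ⟨l, rfl⟩ := Nat.exists_eq_add_of_le' (not_lt.1 hm)
        rw [pow_add, hu0, map_zero]
        exact S.zero_mem
    have h2 : ∀ z, o (φ.symm z) ∈ S := by
      intro z
      induction z using DirectSum.induction_on with
      | zero => rw [map_zero, map_zero]; exact S.zero_mem
      | of i x =>
        obtain ⟨q, rfl⟩ := Submodule.mkQ_surjective _ x
        exact h1 i q
      | add x y hx hy => rw [map_add, map_add]; exact S.add_mem hx hy
    rw [eq_top_iff]
    intro w _
    have := h2 (φ (o.symm w))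
    simpa using this
  · have h1 : Module.finrank ℂ (Module.AEval ℂ (κ → ℂ) f) = Fintype.card κ := by
      rw [← (Module.AEval.of ℂ (κ → ℂ) f).finrank_eq, Module.finrank_fintype_fun_eq_card]
    have h2 : ∀ i, Module.finrank ℂ (ℂ[X] ⧸ ℂ[X] ∙ p i ^ e i) = e i := by
      intro i
      have := finrank_quotient_span_eq_natDegree (f := (X - C (a i)) ^ e i)
      rw [← ha i, natDegree_pow, natDegree_X_sub_C, mul_one] at this
      exact this
    have h3 : ∀ i, Module.Finite ℂ (ℂ[X] ⧸ ℂ[X] ∙ p i ^ e i) := by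
      intro i
      have := ((monic_X_sub_C (a i)).pow (e i)).finite_quotient
      rw [← ha i] at this
      exact this
    rw [← h1, (φ.restrictScalars ℂ).finrank_eq, Module.finrank_directSum]
    exact Finset.sum_congr rfl fun i _ => h2 i

theorem jordanSum_similar_of_rank_eq {ι ι' : Type} [Fintype ι] [DecidableEq ι]
    [Fintype ι'] [DecidableEq ι'] {d : ι → ℂ} {s : ι → ℕ} {d' : ι' → ℂ} {s' : ι' → ℕ}
    (h : ∀ a k, (∑ i, if d i = a then s i - k else s i) =
      ∑ i, if d' i = a then s' i - k else s' i) :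
    MatrixSimilar (jordanSum d s) (jordanSum d' s') := by
  classical
  -- First difference of the ranks: blocks larger than `k`. The second difference, in `hE`, isolates
  -- the blocks of size exactly `k + 1`.
  have hN : ∀ {ι : Type} [Fintype ι] (d : ι → ℂ) (s : ι → ℕ) (a : ℂ) (k : ℕ),
      (∑ i, if d i = a then s i - k else s i) =
        (∑ i, if d i = a then s i - (k + 1) else s i) +
          (Finset.univ.filter fun i => d i = a ∧ k < s i).card := by
    intro ι _ d s a k
    rw [Finset.card_filter, ← Finset.sum_add_distrib]
    refine Finset.sum_congr rfl fun i _ => ?_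
    by_cases h1 : d i = a <;> by_cases h2 : k < s i <;> simp [h1, h2] <;> omega
  have hE : ∀ {ι : Type} [Fintype ι] (d : ι → ℂ) (s : ι → ℕ) (a : ℂ) (k : ℕ),
      (Finset.univ.filter fun i => d i = a ∧ k < s i).card =
        (Finset.univ.filter fun i => d i = a ∧ k + 1 < s i).card +
          (Finset.univ.filter fun i => d i = a ∧ s i = k + 1).card := by
    intro ι _ d s a k
    simp only [Finset.card_filter]
    rw [← Finset.sum_add_distrib]
    refine Finset.sum_congr rfl fun i _ => ?_
    by_cases h1 : d i = a <;> simp only [h1, true_and, false_and, if_false, add_zero]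
    split_ifs <;> omega
  have hfib : ∀ a k, (Finset.univ.filter fun i => d i = a ∧ s i = k + 1).card =
      (Finset.univ.filter fun i => d' i = a ∧ s' i = k + 1).card := by
    intro a k
    have e1 := hN d s a k
    have e2 := hN d' s' a k
    have e3 := hN d s a (k + 1)
    have e4 := hN d' s' a (k + 1)
    have e5 := hE d s a k
    have e6 := hE d' s' a k
    have h1 := h a k
    have h2 := h a (k + 1)
    have h3 := h a (k + 1 + 1)
    omega
  let F : {i // 0 < s i} → ℂ × ℕ := fun i => (d i, s i)
  let F' : {i // 0 < s' i} → ℂ × ℕ := fun i => (d' i, s' i)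
  have hc : ∀ c, Nonempty ({i // F i = c} ≃ {i // F' i = c}) := by
    rintro ⟨a, k⟩
    have hx : ∀ {ι : Type} [Fintype ι] (d : ι → ℂ) (s : ι → ℕ) (k : ℕ),
        Fintype.card {i : {i // 0 < s i} // (d i, s i) = (a, k + 1)} =
          (Finset.univ.filter fun i => d i = a ∧ s i = k + 1).card := by
      intro ι _ d s k
      rw [← Fintype.card_subtype]
      refine Fintype.card_congr ⟨fun x => ⟨x.1.1, by simpa using x.2⟩,
        fun x => ⟨⟨x.1, by omega⟩, by simpa using x.2⟩, fun _ => rfl, fun _ => rfl⟩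
    rcases k with _ | k
    · have e1 : IsEmpty {i // F i = (a, 0)} :=
        ⟨fun x => absurd x.1.2 (by have := congrArg Prod.snd x.2; simp only [F] at this; omega)⟩
      have e2 : IsEmpty {i // F' i = (a, 0)} :=
        ⟨fun x => absurd x.1.2 (by have := congrArg Prod.snd x.2; simp only [F'] at this; omega)⟩
      exact ⟨Equiv.equivOfIsEmpty _ _⟩
    · exact Fintype.card_eq.1 (by rw [hx d s k, hx d' s' k, hfib])
  -- Equal counts over each pair (eigenvalue, size) glue to a bijection of the nonempty blocks.
  let E := Equiv.ofFiberEquiv fun c => (hc c).some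
  have hE' : ∀ i, F' (E i) = F i := Equiv.ofFiberEquiv_map _
  have s1 : MatrixSimilar (jordanSum (fun i : {i // 0 < s i} => d i) (fun i => s i))
      (jordanSum d s) :=
    MatrixSimilar.jordanSum_of_injective Subtype.val Subtype.val_injective (fun _ => rfl)
      (fun _ => rfl) (fun i hi => by simpa using hi)
  have s2 : MatrixSimilar (jordanSum (fun i : {i // 0 < s i} => d i) (fun i => s i))
      (jordanSum d' s') :=
    MatrixSimilar.jordanSum_of_injective (fun i => (E i).1)
      (Subtype.val_injective.comp E.injective) (fun i => congrArg Prod.fst (hE' i))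
      (fun i => congrArg Prod.snd (hE' i)) (fun i hi => by
        by_contra h0
        exact hi ⟨E.symm ⟨i, Nat.pos_of_ne_zero h0⟩, by simp⟩)
  exact s1.symm.trans s2

/-- Similarity classes are separated by the ranks of the powers of `A - a`. -/
theorem similar_of_rank_eq {κ ν : Type} [Fintype κ] [DecidableEq κ] [Fintype ν] [DecidableEq ν]
    {A : Matrix κ κ ℂ} {B : Matrix ν ν ℂ}
    (h : ∀ (a : ℂ) (k : ℕ), ((A - a • (1 : Matrix κ κ ℂ)) ^ k).rank =
      ((B - a • (1 : Matrix ν ν ℂ)) ^ k).rank) : MatrixSimilar A B := by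
  obtain ⟨ι, _, _, d, s, hA⟩ := exists_similar_jordanSum A
  obtain ⟨ι', _, _, d', s', hB⟩ := exists_similar_jordanSum B
  refine hA.trans (MatrixSimilar.trans (jordanSum_similar_of_rank_eq fun a k => ?_) hB.symm)
  rw [← rank_jordanSum_sub_pow, ← rank_jordanSum_sub_pow, ← hA.rank_sub_pow, ← hB.rank_sub_pow, h]

/-! ### Rank bounds for matrices in `V^r`. -/

section Subdiagonal

variable {n r r' : ℕ} {X Y : Matrix (Fin n) (Fin n) ℂ}

theorem mul_mem_subdiagonalSet (hX : X ∈ subdiagonalSet n r) (hY : Y ∈ subdiagonalSet n r') :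
    X * Y ∈ subdiagonalSet n (r + r') := by
  intro i j
  rw [Matrix.mul_apply]
  have h0 : ∀ l : Fin n, (j : ℕ) + r' < l ∨ (l : ℕ) + r < i → X i l * Y l j = 0 := by
    rintro l (h | h)
    · rw [(hY l j).1 h, mul_zero]
    · rw [(hX i l).1 h, zero_mul]
  constructor
  · intro h
    exact Finset.sum_eq_zero fun l _ => h0 l (by omega)
  · intro h
    -- On the extreme subdiagonal only one path from `j` to `i` survives, so no cancellation can
    -- occur.
    rw [Finset.sum_eq_single ⟨j + r', by omega⟩]
    · exact mul_ne_zero ((hX _ _).2 (by simp only; omega)) ((hY _ _).2 rfl)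
    · intro l _ hl
      have : (l : ℕ) ≠ j + r' := fun h => hl (Fin.ext h)
      exact h0 l (by omega)
    · simp

theorem one_mem_subdiagonalSet : (1 : Matrix (Fin n) (Fin n) ℂ) ∈ subdiagonalSet n 0 := by
  intro i j
  constructor
  · intro h
    exact Matrix.one_apply_ne (by rintro rfl; omega)
  · intro h
    obtain rfl : i = j := Fin.ext h
    simp

theorem pow_mem_subdiagonalSet (hX : X ∈ subdiagonalSet n r) (k : ℕ) :
    X ^ k ∈ subdiagonalSet n (r * k) := by
  induction k with
  | zero => simpa using one_mem_subdiagonalSet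
  | succ k ih => rw [pow_succ, Nat.mul_succ]; exact mul_mem_subdiagonalSet ih hX

theorem sub_smul_one_mem_subdiagonalSet (hr : 0 < r) (hX : X ∈ subdiagonalSet n r) (a : ℂ) :
    X - a • (1 : Matrix (Fin n) (Fin n) ℂ) ∈ subdiagonalSet n r := by
  intro i j
  have h : (j : ℕ) + r ≤ i → (X - a • (1 : Matrix (Fin n) (Fin n) ℂ)) i j = X i j := by
    intro h
    have : i ≠ j := by rintro rfl; omega
    simp [this]
  exact ⟨fun h' => (h h'.le).trans ((hX i j).1 h'), fun h' => by
    rw [h h'.ge]; exact (hX i j).2 h'⟩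

/-- Without its first `r` rows and last `r` columns the matrix is upper triangular, with the nonzero
subdiagonal as its diagonal. -/
theorem le_rank_of_mem_subdiagonalSet (hX : X ∈ subdiagonalSet n r) : n - r ≤ X.rank := by
  refine le_trans ?_ (Matrix.rank_submatrix_le X
    (fun i : Fin (n - r) => (⟨i + r, by omega⟩ : Fin n))
    (fun i : Fin (n - r) => ⟨i, by omega⟩))
  rw [Matrix.rank_of_det_ne_zero, Fintype.card_fin]
  rw [Matrix.det_of_isUpperTriangular]
  · exact Finset.prod_ne_zero_iff.2 fun i _ => (hX _ _).2 rfl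
  · intro i j hij
    have : (j : ℕ) < i := hij
    exact (hX _ _).1 (by simp only; omega)

theorem le_rank_sub_pow_of_mem_subdiagonalSet (hr : 0 < r) (hX : X ∈ subdiagonalSet n r) (a : ℂ)
    (k : ℕ) : n - r * k ≤ ((X - a • (1 : Matrix (Fin n) (Fin n) ℂ)) ^ k).rank :=
  le_rank_of_mem_subdiagonalSet
    (pow_mem_subdiagonalSet (sub_smul_one_mem_subdiagonalSet hr hX a) k)

end Subdiagonal

/-! ### Bidiagonal representatives of the balanced orbits. -/

/-- The matrix with diagonal `d` and with ones on the `r`-th subdiagonal. -/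
def bidiagonalMatrix {n : ℕ} (r : ℕ) (d : Fin n → ℂ) : Matrix (Fin n) (Fin n) ℂ :=
  Matrix.of fun i j => if i = j then d j else if (i : ℕ) = j + r then 1 else 0

theorem bidiagonalMatrix_mem_subdiagonalSet {n r : ℕ} (hr : 0 < r) (d : Fin n → ℂ) :
    bidiagonalMatrix r d ∈ subdiagonalSet n r := by
  intro i j
  constructor
  · intro h
    have : i ≠ j := by rintro rfl; omega
    simp only [bidiagonalMatrix, Matrix.of_apply, if_neg this]
    rw [if_neg (by omega)]
  · intro h
    have : i ≠ j := by rintro rfl; omega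
    simp [bidiagonalMatrix, this, h]

/-- On the interval where the diagonal equals `a`, subtracting `a` leaves only the shift by `r`.
Each factor thus pushes basis vectors down by `r` until they leave the interval, and nothing moves
back up. -/
theorem bidiagonalMatrix_sub_pow_apply_eq_zero {n r : ℕ} {d : Fin n → ℂ} {a : ℂ} {s m : ℕ}
    (hd : ∀ j : Fin n, s ≤ j → (j : ℕ) < s + m → d j = a) (k : ℕ) (i j : Fin n) (hj : s ≤ j)
    (hi : (i : ℕ) < s + min m (r * k)) :
    ((bidiagonalMatrix r d - a • (1 : Matrix (Fin n) (Fin n) ℂ)) ^ k) i j = 0 := by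
  induction k generalizing i with
  | zero =>
    rw [pow_zero, Matrix.one_apply_ne]
    rintro rfl
    simp at hi
    omega
  | succ k ih =>
    rw [pow_succ', Matrix.mul_apply]
    refine Finset.sum_eq_zero fun l _ => ?_
    by_cases hl : (l : ℕ) < s + min m (r * k)
    · rw [ih l hl, mul_zero]
    · rw [Nat.mul_succ] at hi
      rw [mul_eq_zero]
      left
      by_cases hil : i = l
      · subst hil
        simp [bidiagonalMatrix, hd i (by omega) (by omega)]
      · have : (i : ℕ) ≠ l + r := by omega
        simp [bidiagonalMatrix, hil, this]

theorem Matrix.rank_add_le_add_rank {m n : Type*} [Fintype m] [Fintype n] (A B : Matrix m n ℂ) :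
    (A + B).rank ≤ A.rank + B.rank := by
  rw [Matrix.rank, Matrix.rank, Matrix.rank, Matrix.mulVecLin_add]
  refine (Submodule.finrank_mono (LinearMap.range_add_le _ _)).trans ?_
  exact Submodule.finrank_add_le_finrank_add_finrank _ _

/-- Columns before `s` contribute rank at most `s`; the others are supported in rows from `s + min m
(r * k)` on. -/
theorem rank_bidiagonalMatrix_sub_pow_le {n r : ℕ} {d : Fin n → ℂ} {a : ℂ} {s m : ℕ}
    (hsm : s + m ≤ n) (hd : ∀ j : Fin n, s ≤ j → (j : ℕ) < s + m → d j = a) (k : ℕ) :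
    ((bidiagonalMatrix r d - a • (1 : Matrix (Fin n) (Fin n) ℂ)) ^ k).rank ≤
      n - min m (r * k) := by
  classical
  set M := (bidiagonalMatrix r d - a • (1 : Matrix (Fin n) (Fin n) ℂ)) ^ k with hM
  have hsplit : M = M * Matrix.diagonal (fun j : Fin n => if (j : ℕ) < s then (1 : ℂ) else 0) +
      M * Matrix.diagonal (fun j : Fin n => if (j : ℕ) < s then (0 : ℂ) else 1) := by
    ext i j
    by_cases h : (j : ℕ) < s <;> simp [h]
  have h1 : (M * Matrix.diagonal (fun j : Fin n => if (j : ℕ) < s then (1 : ℂ) else 0)).rank ≤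
      s := by
    refine (Matrix.rank_mul_le_right _ _).trans ((Matrix.rank_le_card_of_support_subset _
        (Finset.univ.filter fun i : Fin n => (i : ℕ) < s) ?_).trans ?_)
    · intro i hi
      simp only [Finset.coe_filter, Finset.mem_univ, true_and, Set.mem_ofPred_eq]
      by_contra h'
      apply hi
      ext j
      simp [Matrix.diagonal_apply, h']
    · rw [Fin.card_filter_val_lt]; omega
  have h2 : (M * Matrix.diagonal (fun j : Fin n => if (j : ℕ) < s then (0 : ℂ) else 1)).rank ≤
      n - (s + min m (r * k)) := by
    refine (Matrix.rank_le_card_of_support_subset _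
        (Finset.univ.filter fun i : Fin n => ¬ (i : ℕ) < s + min m (r * k)) ?_).trans ?_
    · intro i hi
      simp only [Finset.coe_filter, Finset.mem_univ, true_and, Set.mem_ofPred_eq]
      intro h'
      apply hi
      ext j
      rw [Matrix.row_apply, Matrix.mul_diagonal]
      split_ifs with hj
      · simp
      · rw [hM, bidiagonalMatrix_sub_pow_apply_eq_zero hd k i j (not_lt.1 hj) h', zero_mul]; rfl
    · rw [Finset.filter_not, Finset.card_sdiff_of_subset (Finset.filter_subset _ _),
        Fin.card_filter_val_lt, Finset.card_univ, Fintype.card_fin]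
      omega
  rw [hsplit]
  refine (Matrix.rank_add_le_add_rank _ _).trans ((add_le_add h1 h2).trans ?_)
  omega

/-- Lays the eigenvalues out in consecutive runs, one for each element of `T`. -/
theorem exists_interval_fibers (T : Finset ℂ) (m : ℂ → ℕ) :
    ∃ (d : ℕ → ℂ) (s : ℂ → ℕ), ∀ a ∈ T, s a + m a ≤ ∑ b ∈ T, m b ∧
      ∀ j, s a ≤ j → j < s a + m a → d j = a := by
  classical
  induction T using Finset.induction_on with
  | empty => exact ⟨fun _ => 0, fun _ => 0, by simp⟩
  | insert a T ha ih =>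
    obtain ⟨d, s, h⟩ := ih
    refine ⟨fun j => if j < ∑ b ∈ T, m b then d j else a, Function.update s a (∑ b ∈ T, m b), ?_⟩
    intro b hb
    rw [Finset.sum_insert ha]
    by_cases hba : b = a
    · subst hba
      rw [Function.update_self]
      exact ⟨by omega, fun j h1 h2 => if_neg (by omega)⟩
    · have hbT := (Finset.mem_insert.1 hb).resolve_left hba
      rw [Function.update_of_ne hba]
      obtain ⟨h1, h2⟩ := h b hbT
      exact ⟨by omega, fun j h3 h4 => (if_pos (by omega)).trans (h2 j h3 h4)⟩

/-! ### A determinantal criterion for meeting `V^r`. -/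

section Krylov

variable {R : Type*} [CommRing R] {n : ℕ}

/-- The matrix with columns `e_0, …, e_{r-1}, X e_0, …, X e_{r-1}, X² e_0, …`. -/
def krylovMatrix (r : ℕ) (X : Matrix (Fin n) (Fin n) R) : Matrix (Fin n) (Fin n) R :=
  Matrix.of fun i j => (X ^ ((j : ℕ) / r)) i ⟨(j : ℕ) % r, (Nat.mod_le _ _).trans_lt j.2⟩

/-- Applied to evaluation of the generic matrix, this exhibits the determinant as a polynomial in
the entries. -/
theorem mapMatrix_krylovMatrix {S : Type*} [CommRing S] (f : R →+* S) (r : ℕ)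
    (X : Matrix (Fin n) (Fin n) R) :
    f.mapMatrix (krylovMatrix r X) = krylovMatrix r (f.mapMatrix X) := by
  ext i j
  simp only [krylovMatrix, Matrix.of_apply, ← map_pow]
  rfl

/-- Column `j` is a column of a power of `X`, whose last nonzero entry sits in row `j % r + r * (j /
r) = j`; so the matrix is triangular. -/
theorem det_krylovMatrix_ne_zero {r : ℕ} {X : Matrix (Fin n) (Fin n) ℂ}
    (hX : X ∈ subdiagonalSet n r) : (krylovMatrix r X).det ≠ 0 := by
  have h : ∀ j : Fin n, (j : ℕ) % r + r * (j / r) = j := fun j => Nat.mod_add_div _ _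
  rw [Matrix.det_of_isUpperTriangular]
  · exact Finset.prod_ne_zero_iff.2 fun j _ =>
      (pow_mem_subdiagonalSet hX ((j : ℕ) / r) _ _).2 (h j).symm
  · intro i j hij
    have hij' : (j : ℕ) < i := hij
    exact (pow_mem_subdiagonalSet hX ((j : ℕ) / r) _ _).1 ((h j).trans_lt hij')

/-- In the basis of Krylov columns, `Y` sends the `j`-th vector to the `(j + r)`-th. The columns
with `j + r ≥ n` are unconstrained. -/
theorem exists_similar_mem_subdiagonalSet {r : ℕ} (hr : 0 < r) {Y : Matrix (Fin n) (Fin n) ℂ}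
    (hY : (krylovMatrix r Y).det ≠ 0) : ∃ Z ∈ subdiagonalSet n r, MatrixSimilar Z Y := by
  have hu : IsUnit (krylovMatrix r Y).det := IsUnit.mk0 _ hY
  set K := krylovMatrix r Y with hK
  have hcol : ∀ (i j : Fin n) (h : (j : ℕ) + r < n), (Y * K) i j = K i ⟨j + r, h⟩ := by
    intro i j h
    simp only [hK, krylovMatrix, Matrix.of_apply, Nat.add_div_right _ hr, Nat.add_mod_right,
      pow_succ']
    rfl
  have hZ : ∀ (i j : Fin n) (h : (j : ℕ) + r < n),
      (K⁻¹ * (Y * K)) i j = (1 : Matrix (Fin n) (Fin n) ℂ) i ⟨j + r, h⟩ := by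
    intro i j h
    rw [Matrix.mul_apply]
    simp_rw [fun l => hcol l j h]
    rw [← Matrix.mul_apply, Matrix.nonsing_inv_mul _ hu]
  refine ⟨K⁻¹ * (Y * K), ?_, K⁻¹, K, Matrix.nonsing_inv_mul _ hu, Matrix.mul_nonsing_inv _ hu, ?_⟩
  · intro i j
    constructor
    · intro h
      rw [hZ i j (by omega), Matrix.one_apply_ne]
      intro h'
      have := congrArg Fin.val h'
      simp only at this
      omega
    · intro h
      rw [hZ i j (by omega)]
      have : i = ⟨j + r, by omega⟩ := Fin.ext h
      rw [← this, Matrix.one_apply_eq]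
      exact one_ne_zero
  · rw [Matrix.mul_assoc, Matrix.mul_assoc, Matrix.mul_nonsing_inv _ hu, Matrix.mul_one]

end Krylov

/-! ### Semicontinuity and degenerations along lines. -/

section Closure

variable {n : ℕ}

theorem subset_zariskiClosure (S : Set (Matrix (Fin n) (Fin n) ℂ)) : S ⊆ zariskiClosure S :=
  fun X hX _ hp => hp X hX

theorem AdjointOrbit.ClosureLE.refl (O : AdjointOrbit n) : O.ClosureLE O :=
  subset_zariskiClosure _

theorem AdjointOrbit.ClosureLE.trans {O₁ O₂ O₃ : AdjointOrbit n} (h : O₁.ClosureLE O₂)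
    (h' : O₂.ClosureLE O₃) : O₁.ClosureLE O₃ :=
  fun _ hX p hp => h hX p fun _ hY => h' hY p hp

theorem exists_eval_ne_zero_of_mem_zariskiClosure {S : Set (Matrix (Fin n) (Fin n) ℂ)}
    {X : Matrix (Fin n) (Fin n) ℂ} (hX : X ∈ zariskiClosure S)
    (p : MvPolynomial (Fin n × Fin n) ℂ)
    (h : MvPolynomial.eval (fun ij => X ij.1 ij.2) p ≠ 0) :
    ∃ Y ∈ S, MvPolynomial.eval (fun ij => Y ij.1 ij.2) p ≠ 0 := by
  by_contra! h'
  exact h (hX p h')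

/-- Rank is lower semicontinuous: with `V`, `U` the normalizing factors at `X`, a minor of `V * (Z -
a)^k * U` is polynomial in `Z` and equals 1 at `Z = X`, so it is nonzero somewhere on the orbit of
`Y`. -/
theorem rank_sub_pow_le_of_closureLE {X Y : Matrix (Fin n) (Fin n) ℂ}
    (h : (adjointOrbitOf X).ClosureLE (adjointOrbitOf Y)) (a : ℂ) (k : ℕ) :
    ((X - a • (1 : Matrix (Fin n) (Fin n) ℂ)) ^ k).rank ≤
      ((Y - a • (1 : Matrix (Fin n) (Fin n) ℂ)) ^ k).rank := by
  have hX : X ∈ zariskiClosure (adjointOrbitOf Y).orbit :=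
    h (mem_orbit_adjointOrbitOf.2 (MatrixSimilar.refl X))
  set M := (X - a • (1 : Matrix (Fin n) (Fin n) ℂ)) ^ k with hM
  obtain ⟨V, U, e, -, -, hVU⟩ := Matrix.exists_rank_normal_form M
  let c : Matrix (Fin n) (Fin n) ℂ →+* Matrix (Fin n) (Fin n) (MvPolynomial (Fin n × Fin n) ℂ) :=
    MvPolynomial.C.mapMatrix
  let f : Fin M.rank → Fin n := fun i => e.symm (Sum.inl i)
  let p := ((c V * (Matrix.mvPolynomialX (Fin n) (Fin n) ℂ -
    c (a • (1 : Matrix (Fin n) (Fin n) ℂ))) ^ k * c U).submatrix f f).det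
  have hp : ∀ Y : Matrix (Fin n) (Fin n) ℂ, MvPolynomial.eval (fun ij => Y ij.1 ij.2) p =
      ((V * (Y - a • (1 : Matrix (Fin n) (Fin n) ℂ)) ^ k * U).submatrix f f).det := by
    intro Y
    have hc : ∀ W, (MvPolynomial.eval fun ij : Fin n × Fin n => Y ij.1 ij.2).mapMatrix (c W) =
        W := by
      intro W
      ext i j
      simp [c]
    have hev : (MvPolynomial.eval fun ij : Fin n × Fin n => Y ij.1 ij.2).mapMatrix
        (c V * (Matrix.mvPolynomialX (Fin n) (Fin n) ℂ -
          c (a • (1 : Matrix (Fin n) (Fin n) ℂ))) ^ k * c U) =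
        V * (Y - a • (1 : Matrix (Fin n) (Fin n) ℂ)) ^ k * U := by
      rw [map_mul, map_mul, map_pow, map_sub, hc, hc, hc, Matrix.mvPolynomialX_mapMatrix_eval]
    rw [RingHom.map_det, ← hev]
    rfl
  obtain ⟨Z, hZ, hpZ⟩ := exists_eval_ne_zero_of_mem_zariskiClosure hX p (by
    rw [hp, ← hM, hVU]
    have : ((Matrix.fromBlocks 1 0 0 0 : Matrix (Fin M.rank ⊕ Fin (Fintype.card (Fin n) - M.rank))
        _ ℂ).submatrix e e).submatrix f f = 1 := by
      ext i j
      simp [f]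
    rw [this, Matrix.det_one]
    exact one_ne_zero)
  rw [hp] at hpZ
  rw [← (mem_orbit_adjointOrbitOf.1 hZ).rank_sub_pow a k]
  have h1 := Matrix.rank_of_det_ne_zero hpZ
  rw [Fintype.card_fin] at h1
  refine h1.ge.trans ((Matrix.rank_submatrix_le _ _ _).trans
    ((Matrix.rank_mul_le_left _ _).trans (Matrix.rank_mul_le_right _ _)))

theorem exists_mem_subdiagonalSet_of_closureLE {r : ℕ} (hr : 0 < r)
    {X Y : Matrix (Fin n) (Fin n) ℂ} (hX : X ∈ subdiagonalSet n r)
    (h : (adjointOrbitOf X).ClosureLE (adjointOrbitOf Y)) :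
    ∃ Z ∈ subdiagonalSet n r, MatrixSimilar Z Y := by
  have hp : ∀ Y : Matrix (Fin n) (Fin n) ℂ, MvPolynomial.eval (fun ij => Y ij.1 ij.2)
      (krylovMatrix r (Matrix.mvPolynomialX (Fin n) (Fin n) ℂ)).det = (krylovMatrix r Y).det := by
    intro Y
    rw [RingHom.map_det, mapMatrix_krylovMatrix, Matrix.mvPolynomialX_mapMatrix_eval]
  obtain ⟨Z, hZ, hpZ⟩ := exists_eval_ne_zero_of_mem_zariskiClosure
    (h (mem_orbit_adjointOrbitOf.2 (MatrixSimilar.refl X)))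
    (krylovMatrix r (Matrix.mvPolynomialX (Fin n) (Fin n) ℂ)).det
    (by rw [hp]; exact det_krylovMatrix_ne_zero hX)
  rw [hp] at hpZ
  obtain ⟨W, hW, hWZ⟩ := exists_similar_mem_subdiagonalSet hr hpZ
  exact ⟨W, hW, hWZ.trans (mem_orbit_adjointOrbitOf.1 hZ)⟩

/-- A polynomial vanishing on the orbit of `Y` vanishes on the conjugated line for `t ≠ 0`, hence by
continuity at `t = 0`. -/
theorem closureLE_of_forall_ne_zero {X Y E : Matrix (Fin n) (Fin n) ℂ}
    (h : ∀ t : ℂ, t ≠ 0 → MatrixSimilar (X + t • E) Y) :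
    (adjointOrbitOf X).ClosureLE (adjointOrbitOf Y) := by
  intro Z hZ p hp
  obtain ⟨P, Q, hPQ, hQP, hZX⟩ := mem_orbit_adjointOrbitOf.1 hZ
  have hZ' : Z = P * X * Q := by rw [← hZX, Matrix.mul_assoc, hPQ, Matrix.mul_one]
  let g : ℂ → ℂ := fun t => MvPolynomial.eval (fun ij => (P * (X + t • E) * Q) ij.1 ij.2) p
  have hg : Continuous g := by
    refine p.continuous_eval.comp (continuous_pi fun ij => ?_)
    have : Continuous fun t : ℂ => P * (X + t • E) * Q := by fun_prop
    exact this.matrix_elem _ _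
  have hg0 : ∀ t, t ≠ 0 → g t = 0 := by
    intro t ht
    refine hp _ (mem_orbit_adjointOrbitOf.2 (MatrixSimilar.trans ⟨P, Q, hPQ, hQP, ?_⟩ (h t ht)))
    rw [Matrix.mul_assoc, hQP, Matrix.mul_one]
  have hgz : g = fun _ => 0 :=
    hg.ext_on (dense_compl_singleton (0 : ℂ)) continuous_const fun t ht => hg0 t ht
  have := congrFun hgz 0
  simpa [g, hZ'] using this

end Closure

/-! ### Balancing the sizes of Jordan blocks. -/

section Degeneration

variable {ι : Type*} [Fintype ι] [DecidableEq ι]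

/-- The standard basis vectors of `jordanSum d s`, extended by zero. -/
noncomputable def jordanVec (s : ι → ℕ) (i : ι) (j : ℕ) : ((i : ι) × Fin (s i)) → ℂ :=
  if h : j < s i then Pi.single ⟨i, j, h⟩ 1 else 0

theorem jordanSum_mulVec_jordanVec_zero (d : ι → ℂ) {s : ι → ℕ} {i : ι} (h : 0 < s i) :
    (jordanSum d s).mulVec (jordanVec s i 0) = d i • jordanVec s i 0 := by
  ext x
  obtain ⟨i', j'⟩ := x
  simp only [jordanVec, dif_pos h, Matrix.mulVec_single_one, Matrix.col_apply, jordanSum_apply,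
    Pi.smul_apply, Pi.single_apply, smul_eq_mul]
  by_cases hi : i' = i
  · subst hi
    by_cases hj : (j' : ℕ) = 0 <;> simp [hj, Fin.ext_iff]
  · simp [hi]

theorem jordanSum_mulVec_jordanVec_succ (d : ι → ℂ) {s : ι → ℕ} {i : ι} {j : ℕ}
    (h : j + 1 < s i) :
    (jordanSum d s).mulVec (jordanVec s i (j + 1)) =
      d i • jordanVec s i (j + 1) + jordanVec s i j := by
  have h' : j < s i := by omega
  ext x
  obtain ⟨i', j'⟩ := x
  simp only [jordanVec, dif_pos h, dif_pos h', Matrix.mulVec_single_one, Matrix.col_apply,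
    jordanSum_apply, Pi.add_apply, Pi.smul_apply, Pi.single_apply, smul_eq_mul]
  by_cases hi : i' = i
  · subst hi
    by_cases hj : (j' : ℕ) = j + 1
    · simp [hj, Fin.ext_iff]
    · by_cases hj' : (j' : ℕ) = j <;> simp [hj, hj', Fin.ext_iff]
  · simp [hi]

theorem single_mulVec_jordanVec {s : ι → ℕ} {i₁ i₂ : ι} (h₁ : 0 < s i₁) (h₂ : 0 < s i₂) (i : ι)
    (j : ℕ) :
    (Matrix.single (⟨i₂, 0, h₂⟩ : (i : ι) × Fin (s i)) (⟨i₁, 0, h₁⟩ : (i : ι) × Fin (s i))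
      (1 : ℂ)).mulVec (jordanVec s i j) =
      if i = i₁ ∧ j = 0 then jordanVec s i₂ 0 else 0 := by
  ext x
  by_cases hj : j < s i
  · simp only [jordanVec, dif_pos hj, Matrix.mulVec_single_one, Matrix.col_apply,
      Matrix.single_apply, dif_pos h₂]
    by_cases hi : i = i₁
    · subst hi
      by_cases hj0 : j = 0
      · subst hj0
        simp [Pi.single_apply, eq_comm]
      · have : (0 : ℕ) ≠ j := fun h => hj0 h.symm
        simp [hj0, this]
    · have : i₁ ≠ i := fun h => hi h.symm
      simp [hi, this]
  · have : ¬ (i = i₁ ∧ j = 0) := by rintro ⟨rfl, rfl⟩; exact hj h₁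
    simp [jordanVec, dif_neg hj, this]

theorem sum_eq_sum_of_move {s s' : ι → ℕ} {i₁ i₂ : ι} (hi : i₁ ≠ i₂) (hs₁ : s' i₁ + 1 = s i₁)
    (hs₂ : s' i₂ = s i₂ + 1) (hs : ∀ i, i ≠ i₁ → i ≠ i₂ → s' i = s i) (p : ι → Prop)
    [DecidablePred p] (hp : p i₁ ↔ p i₂) :
    (∑ i, if p i then s' i else 0) = ∑ i, if p i then s i else 0 := by
  have h : (∑ i, if p i then s' i else 0) + (∑ i, if i = i₁ then (if p i₁ then 1 else 0) else 0) =
      (∑ i, if p i then s i else 0) + ∑ i, if i = i₂ then (if p i₁ then 1 else 0) else 0 := by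
    rw [← Finset.sum_add_distrib, ← Finset.sum_add_distrib]
    refine Finset.sum_congr rfl fun i _ => ?_
    by_cases h1 : i = i₁
    · subst h1
      by_cases h3 : p i <;> simp [h3, hi, hs₁]
    · by_cases h2 : i = i₂
      · subst h2
        by_cases h3 : p i <;> simp [h3, hp, h1, hs₂]
      · simp [h1, h2, hs i h1 h2]
  simpa using h

/-- Two Jordan blocks of sizes `p - 1 ≥ q + 1` with the same eigenvalue, joined by a nonzero
entry, form a matrix similar to the sum of Jordan blocks of sizes `p` and `q`. -/
theorem jordanSum_add_single_similar {d : ι → ℂ} {s s' : ι → ℕ} {i₁ i₂ : ι} (hi : i₁ ≠ i₂)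
    (hd : d i₁ = d i₂) (hs₁ : s' i₁ + 1 = s i₁) (hs₂ : s' i₂ = s i₂ + 1)
    (hs : ∀ i, i ≠ i₁ → i ≠ i₂ → s' i = s i) (hle : s' i₂ ≤ s' i₁) (h₁ : 0 < s' i₁)
    (h₂ : 0 < s' i₂) {t : ℂ} (ht : t ≠ 0) :
    MatrixSimilar (jordanSum d s' + t • Matrix.single (⟨i₂, 0, h₂⟩ : (i : ι) × Fin (s' i))
      (⟨i₁, 0, h₁⟩ : (i : ι) × Fin (s' i)) (1 : ℂ)) (jordanSum d s) := by
  set A := jordanSum d s' + t • Matrix.single (⟨i₂, 0, h₂⟩ : (i : ι) × Fin (s' i))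
      (⟨i₁, 0, h₁⟩ : (i : ι) × Fin (s' i)) (1 : ℂ) with hA
  set c := jordanVec s' with hc
  have hA0 : ∀ i, i ≠ i₁ → 0 < s' i → A.mulVec (c i 0) = d i • c i 0 := by
    intro i h h0
    rw [hA, Matrix.add_mulVec, Matrix.smul_mulVec, single_mulVec_jordanVec,
      if_neg (by simp [h]), jordanSum_mulVec_jordanVec_zero d h0, smul_zero, add_zero]
  have hA1 : A.mulVec (c i₁ 0) = d i₁ • c i₁ 0 + t • c i₂ 0 := by
    rw [hA, Matrix.add_mulVec, Matrix.smul_mulVec, single_mulVec_jordanVec,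
      if_pos (by simp), jordanSum_mulVec_jordanVec_zero d h₁]
  have hAs : ∀ i j, j + 1 < s' i → A.mulVec (c i (j + 1)) = d i • c i (j + 1) + c i j := by
    intro i j h
    rw [hA, Matrix.add_mulVec, Matrix.smul_mulVec, single_mulVec_jordanVec,
      if_neg (by simp), jordanSum_mulVec_jordanVec_succ d h, smul_zero, add_zero]
  -- The new entry sends the bottom of chain `i₁` onto the bottom of chain `i₂`, so chain `i₁` gains
  -- `t • c i₂ 0` below it. Chain `i₂` loses that vector, and the correction `t⁻¹ • c i₁ j` makes
  -- its new bottom an eigenvector.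
  let v : ι → ℕ → ((i : ι) × Fin (s' i)) → ℂ := fun i j =>
    if i = i₁ then (if j = 0 then t • c i₂ 0 else c i₁ (j - 1))
    else if i = i₂ then c i₂ (j + 1) - t⁻¹ • c i₁ j else c i j
  have v10 : v i₁ 0 = t • c i₂ 0 := by simp [v]
  have v1s : ∀ j, v i₁ (j + 1) = c i₁ j := fun j => by simp [v]
  have v2 : ∀ j, v i₂ j = c i₂ (j + 1) - t⁻¹ • c i₁ j := fun j => by simp [v, hi.symm]
  have vo : ∀ i, i ≠ i₁ → i ≠ i₂ → ∀ j, v i j = c i j := fun i h h' j => by simp [v, h, h']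
  refine MatrixSimilar.jordanSum_of_chains A d s v ?_ ?_ ?_ ?_
  · intro i h
    by_cases e1 : i = i₁
    · subst e1
      rw [v10, Matrix.mulVec_smul, hA0 i₂ hi.symm h₂, hd, smul_comm]
    · by_cases e2 : i = i₂
      · subst e2
        rw [v2, Matrix.mulVec_sub, Matrix.mulVec_smul, hA1, hAs i 0 (by omega), hd, smul_add,
          smul_smul t⁻¹ t, inv_mul_cancel₀ ht, one_smul, smul_sub, smul_comm (d i) t⁻¹]
        abel
      · rw [vo i e1 e2, hA0 i e1 (by rw [hs i e1 e2]; exact h)]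
  · intro i j h
    by_cases e1 : i = i₁
    · subst e1
      rcases j with _ | j
      · rw [v1s, v10, hA1]
      · rw [v1s, v1s, hAs _ _ (by omega)]
    · by_cases e2 : i = i₂
      · subst e2
        rw [v2, v2, Matrix.mulVec_sub, Matrix.mulVec_smul, hAs i _ (by omega),
          hAs i₁ _ (by omega), hd, smul_add, smul_sub, smul_comm (d i) t⁻¹]
        abel
      · rw [vo i e1 e2, vo i e1 e2, hAs i j (by rw [hs i e1 e2]; exact h)]
  · intro S hS
    have m1 : ∀ j, j < s' i₁ → c i₁ j ∈ S := fun j hj => by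
      rw [← v1s]; exact hS _ _ (by omega)
    have m2 : ∀ j, j < s' i₂ → c i₂ j ∈ S := by
      intro j hj
      rcases j with _ | j
      · have := S.smul_mem t⁻¹ (hS i₁ 0 (by omega))
        rwa [v10, smul_smul, inv_mul_cancel₀ ht, one_smul] at this
      · have := S.add_mem (hS i₂ j (by omega)) (S.smul_mem t⁻¹ (m1 j (by omega)))
        rwa [v2, sub_add_cancel] at this
    have m3 : ∀ i j, j < s' i → c i j ∈ S := by
      intro i j hj
      by_cases e1 : i = i₁
      · subst e1; exact m1 j hj
      · by_cases e2 : i = i₂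
        · subst e2; exact m2 j hj
        · rw [← vo i e1 e2]; exact hS _ _ (by rw [← hs i e1 e2]; exact hj)
    rw [eq_top_iff, ← (Pi.basisFun ℂ ((i : ι) × Fin (s' i))).span_eq, Submodule.span_le]
    rintro _ ⟨⟨i, j, hj⟩, rfl⟩
    have := m3 i j hj
    simp only [hc, jordanVec, dif_pos hj] at this
    rw [Pi.basisFun_apply]
    exact this
  · have := sum_eq_sum_of_move hi hs₁ hs₂ hs (fun _ => True) Iff.rfl
    simpa using this

theorem exists_closureLE_of_move {n : ℕ} {d : ι → ℂ} {s : ι → ℕ} {i₁ i₂ : ι}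
    (hd : d i₁ = d i₂) (hlt : s i₂ + 1 < s i₁) {Y : Matrix (Fin n) (Fin n) ℂ}
    (hY : MatrixSimilar Y (jordanSum d s)) :
    ∃ (s' : ι → ℕ) (X : Matrix (Fin n) (Fin n) ℂ), MatrixSimilar X (jordanSum d s') ∧
      (adjointOrbitOf X).ClosureLE (adjointOrbitOf Y) ∧ ∑ i, s' i ^ 2 < ∑ i, s i ^ 2 ∧
      ∀ a, (∑ i, if d i = a then s' i else 0) = ∑ i, if d i = a then s i else 0 := by
  have hi : i₁ ≠ i₂ := by rintro rfl; omega
  set s' : ι → ℕ := fun i => if i = i₁ then s i₁ - 1 else if i = i₂ then s i₂ + 1 else s i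
    with hs'
  have hs₁ : s' i₁ + 1 = s i₁ := by simp [hs']; omega
  have hs₂ : s' i₂ = s i₂ + 1 := by simp [hs', hi.symm]
  have hs : ∀ i, i ≠ i₁ → i ≠ i₂ → s' i = s i := fun i h h' => by simp [hs', h, h']
  have hcard : Fintype.card ((i : ι) × Fin (s' i)) = n := by
    have h1 := hY.card_eq
    have h2 := sum_eq_sum_of_move hi hs₁ hs₂ hs (fun _ => True) Iff.rfl
    simp only [Fintype.card_fin, Fintype.card_sigma] at h1
    simp only [if_true] at h2
    simp only [Fintype.card_fin, Fintype.card_sigma]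
    omega
  have e := Fintype.equivFinOfCardEq hcard
  refine ⟨s', Matrix.reindex e e (jordanSum d s'), MatrixSimilar.reindex _ _, ?_, ?_, ?_⟩
  · refine closureLE_of_forall_ne_zero (E := Matrix.reindex e e
      (Matrix.single (⟨i₂, 0, by omega⟩ : (i : ι) × Fin (s' i))
      (⟨i₁, 0, by omega⟩ : (i : ι) × Fin (s' i)) (1 : ℂ))) fun t ht => ?_
    exact ((MatrixSimilar.reindex _ e).trans (jordanSum_add_single_similar hi hd hs₁ hs₂ hs
      (by omega) (by omega) (by omega) ht)).trans hY.symm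
  -- Only two terms change: one drops by `2 * s' i₁ + 1`, the other rises by `2 * s i₂ + 1`, and `s
  -- i₂ < s' i₁`.
  · have h : ∑ i, (s' i ^ 2 + if i = i₁ then s i₁ ^ 2 - s' i₁ ^ 2 else 0) =
        ∑ i, (s i ^ 2 + if i = i₂ then s' i₂ ^ 2 - s i₂ ^ 2 else 0) := by
      refine Finset.sum_congr rfl fun i _ => ?_
      by_cases e1 : i = i₁
      · subst e1
        have : s' i ^ 2 ≤ s i ^ 2 := Nat.pow_le_pow_left (by omega) 2
        simp [hi]; omega
      · by_cases e2 : i = i₂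
        · subst e2
          have : s i ^ 2 ≤ s' i ^ 2 := Nat.pow_le_pow_left (by omega) 2
          simp [e1]; omega
        · simp [e1, e2, hs i e1 e2]
    rw [Finset.sum_add_distrib, Finset.sum_add_distrib] at h
    simp only [Finset.sum_ite_eq', Finset.mem_univ, if_true] at h
    have h3 : s i₁ ^ 2 = s' i₁ ^ 2 + (2 * s' i₁ + 1) := by rw [← hs₁]; ring
    have h4 : s' i₂ ^ 2 = s i₂ ^ 2 + (2 * s i₂ + 1) := by rw [hs₂]; ring
    omega
  · intro a
    exact sum_eq_sum_of_move hi hs₁ hs₂ hs (fun i => d i = a) (by rw [hd])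

/-- Each move lowers the sum of squares, so the process stops, and it can only stop when no move is
available. -/
theorem exists_closureLE_balanced {n : ℕ} {d : ι → ℂ} (s : ι → ℕ)
    (Y : Matrix (Fin n) (Fin n) ℂ) (hY : MatrixSimilar Y (jordanSum d s)) :
    ∃ (s' : ι → ℕ) (X : Matrix (Fin n) (Fin n) ℂ), MatrixSimilar X (jordanSum d s') ∧
      (adjointOrbitOf X).ClosureLE (adjointOrbitOf Y) ∧
      (∀ i j, d i = d j → s' i ≤ s' j + 1) ∧
      ∀ a, (∑ i, if d i = a then s' i else 0) = ∑ i, if d i = a then s i else 0 := by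
  induction hN : ∑ i, s i ^ 2 using Nat.strong_induction_on generalizing s Y with
  | _ N ih =>
  by_cases hbal : ∀ i j, d i = d j → s i ≤ s j + 1
  · exact ⟨s, Y, hY, AdjointOrbit.ClosureLE.refl _, hbal, fun _ => rfl⟩
  · push Not at hbal
    obtain ⟨i₁, i₂, hd, hlt⟩ := hbal
    obtain ⟨s₁, Y₁, hY₁, hle₁, hlt₁, hsum₁⟩ := exists_closureLE_of_move hd hlt hY
    obtain ⟨s₂, X, hX, hle₂, hbal₂, hsum₂⟩ := ih _ (hN ▸ hlt₁) s₁ Y₁ hY₁ rfl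
    exact ⟨s₂, X, hX, hle₂.trans hle₁, hbal₂, fun a => (hsum₂ a).trans (hsum₁ a)⟩

end Degeneration

/-! ### Rank functions of Jordan matrices and rigidity of the balanced orbit. -/

/-- Sizes differing by at most one are all `≥ k` or all `≤ k`, so truncation affects either no term
or the whole sum. -/
theorem sum_tsub_of_balanced {ι : Type*} (F : Finset ι) (s : ι → ℕ)
    (h : ∀ i ∈ F, ∀ j ∈ F, s i ≤ s j + 1) (k : ℕ) :
    ∑ i ∈ F, (s i - k) = ∑ i ∈ F, s i - F.card * k := by
  by_cases hk : ∃ i ∈ F, k < s i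
  · obtain ⟨i, hi, hki⟩ := hk
    have h1 : ∑ j ∈ F, (s j - k) + ∑ _j ∈ F, k = ∑ j ∈ F, s j := by
      rw [← Finset.sum_add_distrib]
      refine Finset.sum_congr rfl fun j hj => ?_
      have := h i hi j hj
      omega
    rw [Finset.sum_const, smul_eq_mul] at h1
    omega
  · push Not at hk
    have h1 : ∑ j ∈ F, s j ≤ F.card * k := by
      simpa using Finset.sum_le_card_nsmul F s k hk
    rw [Nat.sub_eq_zero_of_le h1]
    exact Finset.sum_eq_zero fun j hj => Nat.sub_eq_zero_of_le (hk j hj)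

section JordanMatrix

variable {n : ℕ}

theorem jordanMatrix_similar (q : MonicPoly n) (L : JordanData q.1) :
    MatrixSimilar (jordanMatrix q L) (jordanSum (fun b : JordanBlockIndex L => b.1.1)
      fun b => partAt (L b.1) b.2) :=
  MatrixSimilar.reindex _ _

theorem sum_jordanBlockIndex {q : ℂ[X]} (L : JordanData q) (g : ℂ → ℕ → ℕ) :
    ∑ b : JordanBlockIndex L, g b.1 (partAt (L b.1) b.2) =
      ∑ a ∈ q.roots.toFinset, ((L a).parts.map (g a)).sum := by
  have h : ∀ a : ℂ, ∑ j, g a (partAt (L a) j) = ((L a).parts.map (g a)).sum := by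
    intro a
    rw [← List.sum_ofFn]
    conv_rhs => rw [← Multiset.sort_eq (L a).parts (· ≥ ·), Multiset.map_coe, Multiset.sum_coe]
    congr 1
    conv_rhs => rw [← List.ofFn_get ((L a).parts.sort (· ≥ ·)), List.map_ofFn]
    rfl
  rw [Fintype.sum_sigma]
  simp only [h]
  exact Finset.sum_coe_sort q.roots.toFinset fun a => ((L a).parts.map (g a)).sum

theorem parts_eq_zero_of_notMem_roots {q : ℂ[X]} (L : JordanData q) {a : ℂ}
    (ha : a ∉ q.roots.toFinset) : (L a).parts = 0 := by
  have h : q.rootMultiplicity a = 0 := by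
    rw [← count_roots]
    exact Multiset.count_eq_zero.2 fun h => ha (Multiset.mem_toFinset.2 h)
  have hs := (L a).parts_sum.trans h
  rw [Multiset.sum_eq_zero_iff] at hs
  refine Multiset.eq_zero_of_forall_notMem fun x hx => ?_
  exact absurd ((L a).parts_pos hx) (by rw [hs x hx]; exact lt_irrefl 0)

theorem sum_jordanBlockIndex_ite {q : ℂ[X]} (L : JordanData q) (a : ℂ) (g : ℕ → ℕ) :
    (∑ b : JordanBlockIndex L, if b.1.1 = a then g (partAt (L b.1) b.2) else 0) =
      ((L a).parts.map g).sum := by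
  classical
  rw [sum_jordanBlockIndex L fun b p => if b = a then g p else 0]
  by_cases ha : a ∈ q.roots.toFinset
  · rw [Finset.sum_eq_single_of_mem a ha]
    · simp
    · intro b _ hb
      simp [hb]
  · rw [parts_eq_zero_of_notMem_roots L ha, Finset.sum_eq_zero]
    · rfl
    · intro b hb
      have : b ≠ a := by rintro rfl; exact ha hb
      simp [this]

theorem rank_jordanMatrix_sub_pow (q : MonicPoly n) (L : JordanData q.1) (a : ℂ) (k : ℕ) :
    ((jordanMatrix q L - a • (1 : Matrix (Fin n) (Fin n) ℂ)) ^ k).rank +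
      q.1.rootMultiplicity a = n + ((L a).parts.map (· - k)).sum := by
  have hm : q.1.rootMultiplicity a =
      ∑ b : JordanBlockIndex L, if b.1.1 = a then partAt (L b.1) b.2 else 0 := by
    rw [sum_jordanBlockIndex_ite L a fun p => p, Multiset.map_id', (L a).parts_sum]
  have hn : n = ∑ b : JordanBlockIndex L, partAt (L b.1) b.2 := by
    have := (jordanMatrix_similar q L).card_eq
    simpa [Fintype.card_sigma] using this
  have key : (∑ b : JordanBlockIndex L,
      if b.1.1 = a then partAt (L b.1) b.2 - k else partAt (L b.1) b.2) +
        (∑ b : JordanBlockIndex L, if b.1.1 = a then partAt (L b.1) b.2 else 0) =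
      (∑ b : JordanBlockIndex L, partAt (L b.1) b.2) +
        ∑ b : JordanBlockIndex L, if b.1.1 = a then partAt (L b.1) b.2 - k else 0 := by
    rw [← Finset.sum_add_distrib, ← Finset.sum_add_distrib]
    refine Finset.sum_congr rfl fun b _ => ?_
    split_ifs <;> omega
  rw [(jordanMatrix_similar q L).rank_sub_pow, rank_jordanSum_sub_pow,
    ← sum_jordanBlockIndex_ite L a (· - k)]
  omega

theorem sum_rootMultiplicity (q : MonicPoly n) :
    ∑ a ∈ q.1.roots.toFinset, q.1.rootMultiplicity a = n := by
  classical
  simp only [← count_roots]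
  rw [Multiset.toFinset_sum_count_eq, ← (IsAlgClosed.splits q.1).natDegree_eq_card_roots, q.2.2]

theorem rootMultiplicity_eq_zero_of_notMem (q : MonicPoly n) {a : ℂ}
    (ha : a ∉ q.1.roots.toFinset) : q.1.rootMultiplicity a = 0 := by
  classical
  rw [← count_roots]
  exact Multiset.count_eq_zero.2 fun h => ha (Multiset.mem_toFinset.2 h)

theorem rootMultiplicity_le (q : MonicPoly n) (a : ℂ) : q.1.rootMultiplicity a ≤ n := by
  by_cases ha : a ∈ q.1.roots.toFinset
  · exact (Finset.single_le_sum (f := fun a => q.1.rootMultiplicity a) (fun _ _ => Nat.zero_le _)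
      ha).trans (sum_rootMultiplicity q).le
  · rw [rootMultiplicity_eq_zero_of_notMem q ha]; exact Nat.zero_le _

theorem sum_map_tsub_filter_ne_zero (k : ℕ) (t : Multiset ℕ) :
    ((t.filter (· ≠ 0)).map (· - k)).sum = (t.map (· - k)).sum := by
  induction t using Multiset.induction_on with
  | empty => rfl
  | cons x t ih => by_cases hx : x = 0 <;> simpa [hx] using ih

theorem sum_balancedPartition_tsub {r : ℕ} (hr : 0 < r) (m k : ℕ) :
    ((balancedPartition r m).parts.map (· - k)).sum = m - r * k := by
  have hparts : (balancedPartition r m).parts = (Multiset.replicate (m % r) (m / r + 1) +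
      Multiset.replicate (r - m % r) (m / r)).filter (· ≠ 0) := rfl
  rw [hparts, sum_map_tsub_filter_ne_zero]
  simp only [Multiset.map_add, Multiset.map_replicate, Multiset.sum_add, Multiset.sum_replicate,
    smul_eq_mul]
  have h1 := Nat.div_add_mod m r
  have h2 := Nat.mod_lt m hr
  obtain ⟨c, hc⟩ := Nat.exists_eq_add_of_le h2.le
  have h3 : r - m % r = c := by omega
  rw [h3]
  generalize m % r = x at *
  generalize m / r = y at *
  by_cases hk : k ≤ y
  · obtain ⟨z, rfl⟩ := Nat.exists_eq_add_of_le hk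
    rw [show k + z + 1 - k = z + 1 by omega, show k + z - k = z by omega]
    have : m = r * k + (x * (z + 1) + c * z) := by rw [← h1, hc]; ring
    omega
  · have h4 : r * (y + 1) ≤ r * k := Nat.mul_le_mul_left _ (by omega)
    rw [show y + 1 - k = 0 by omega, show y - k = 0 by omega]
    rw [Nat.mul_succ] at h4
    omega

theorem rank_balanced_sub_pow {r : ℕ} (hr : 0 < r) (q : MonicPoly n) (a : ℂ) (k : ℕ) :
    ((jordanMatrix q (fun a => balancedPartition r (q.1.rootMultiplicity a)) -
      a • (1 : Matrix (Fin n) (Fin n) ℂ)) ^ k).rank =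
      n - min (q.1.rootMultiplicity a) (r * k) := by
  have h := rank_jordanMatrix_sub_pow q
    (fun a => balancedPartition r (q.1.rootMultiplicity a)) a k
  rw [sum_balancedPartition_tsub hr] at h
  have := rootMultiplicity_le q a
  omega

/-- Each kernel dimension is at most the total size of the blocks with that eigenvalue, and each
block has only one eigenvalue. -/
theorem sum_card_sub_rank_le (X : Matrix (Fin n) (Fin n) ℂ) (T : Finset ℂ) (k : ℂ → ℕ) :
    ∑ a ∈ T, (n - ((X - a • (1 : Matrix (Fin n) (Fin n) ℂ)) ^ k a).rank) ≤ n := by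
  classical
  obtain ⟨ι, _, _, d, s, hX⟩ := exists_similar_jordanSum X
  have hn : n = ∑ i, s i := by simpa [Fintype.card_sigma] using hX.card_eq
  calc ∑ a ∈ T, (n - ((X - a • (1 : Matrix (Fin n) (Fin n) ℂ)) ^ k a).rank)
      ≤ ∑ a ∈ T, ∑ i, (if d i = a then s i else 0) := by
        refine Finset.sum_le_sum fun a _ => ?_
        rw [hX.rank_sub_pow, rank_jordanSum_sub_pow, tsub_le_iff_right]
        conv_lhs => rw [hn]
        rw [← Finset.sum_add_distrib]
        refine Finset.sum_le_sum fun i _ => ?_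
        split_ifs <;> omega
    _ = ∑ i, ∑ a ∈ T, (if d i = a then s i else 0) := Finset.sum_comm
    _ ≤ ∑ i, s i := by
        refine Finset.sum_le_sum fun i _ => ?_
        rw [Finset.sum_ite_eq]
        split_ifs <;> omega
    _ = n := hn.symm

/-- The characteristic polynomial of `X` need not be known: the upper bounds make every generalized
eigenspace at least as large as `q` prescribes, and the dimensions already add up to `n`. -/
theorem adjointOrbitOf_eq_balancedOrbit {r : ℕ} (hr : 0 < r) (q : MonicPoly n)
    {X : Matrix (Fin n) (Fin n) ℂ}
    (hlow : ∀ (a : ℂ) (k : ℕ), n - r * k ≤ ((X - a • (1 : Matrix (Fin n) (Fin n) ℂ)) ^ k).rank)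
    (hup : ∀ (a : ℂ) (k : ℕ), ((X - a • (1 : Matrix (Fin n) (Fin n) ℂ)) ^ k).rank ≤
      n - min (q.1.rootMultiplicity a) (r * k)) :
    adjointOrbitOf X = balancedOrbit r q := by
  classical
  refine adjointOrbitOf_eq_iff.2 (similar_of_rank_eq fun a k => ?_)
  rw [rank_balanced_sub_pow hr]
  have key : n - ((X - a • (1 : Matrix (Fin n) (Fin n) ℂ)) ^ k).rank ≤
      q.1.rootMultiplicity a := by
    -- Exponent `n` at the other eigenvalues makes `min m_b (r * n) = m_b`; inserting `a` covers the
    -- case that it is not a root.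
    have h1 := sum_card_sub_rank_le X (insert a q.1.roots.toFinset)
      (Function.update (fun _ => n) a k)
    rw [← Finset.insert_erase (Finset.mem_insert_self a q.1.roots.toFinset),
      Finset.sum_insert (Finset.notMem_erase _ _), Function.update_self] at h1
    have h2 : ∑ b ∈ (insert a q.1.roots.toFinset).erase a, q.1.rootMultiplicity b ≤
        ∑ b ∈ (insert a q.1.roots.toFinset).erase a,
          (n - ((X - b • (1 : Matrix (Fin n) (Fin n) ℂ)) ^
            (Function.update (fun _ => n) a k b)).rank) := by
      refine Finset.sum_le_sum fun b hb => ?_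
      rw [Function.update_of_ne (Finset.ne_of_mem_erase hb)]
      have h3 := hup b n
      have h4 := rootMultiplicity_le q b
      have h5 : n ≤ r * n := Nat.le_mul_of_pos_left n hr
      omega
    have h3 : q.1.rootMultiplicity a +
        ∑ b ∈ (insert a q.1.roots.toFinset).erase a, q.1.rootMultiplicity b = n := by
      rw [Finset.add_sum_erase _ (fun b => q.1.rootMultiplicity b) (Finset.mem_insert_self _ _)]
      by_cases ha : a ∈ q.1.roots.toFinset
      · rw [Finset.insert_eq_of_mem ha, sum_rootMultiplicity]
      · rw [Finset.sum_insert ha, rootMultiplicity_eq_zero_of_notMem q ha, zero_add,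
          sum_rootMultiplicity]
    omega
  have h1 := hlow a k
  have h2 := hup a k
  omega

end JordanMatrix

/-! ### Orbits meeting `V^r` and their minimal elements. -/

theorem mem_orbitsMeeting_iff {n r : ℕ} {X : Matrix (Fin n) (Fin n) ℂ} :
    adjointOrbitOf X ∈ orbitsMeeting n r ↔ ∃ Z ∈ subdiagonalSet n r, MatrixSimilar Z X := by
  constructor
  · rintro ⟨Z, hZ, hZ'⟩
    exact ⟨Z, hZ', mem_orbit_adjointOrbitOf.1 hZ⟩
  · rintro ⟨Z, hZ, hZ'⟩
    exact ⟨Z, mem_orbit_adjointOrbitOf.2 hZ', hZ⟩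

theorem exists_mem_subdiagonalSet_balancedOrbit {n r : ℕ} (hr : 0 < r) (q : MonicPoly n) :
    ∃ X ∈ subdiagonalSet n r, adjointOrbitOf X = balancedOrbit r q := by
  obtain ⟨d, s, h⟩ := exists_interval_fibers q.1.roots.toFinset fun a => q.1.rootMultiplicity a
  have hX := bidiagonalMatrix_mem_subdiagonalSet hr fun j : Fin n => d j
  refine ⟨_, hX, adjointOrbitOf_eq_balancedOrbit hr q
    (le_rank_sub_pow_of_mem_subdiagonalSet hr hX) fun a k => ?_⟩
  by_cases ha : a ∈ q.1.roots.toFinset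
  · obtain ⟨h1, h2⟩ := h a ha
    rw [sum_rootMultiplicity] at h1
    exact rank_bidiagonalMatrix_sub_pow_le h1 (fun j => h2 j) k
  · rw [rootMultiplicity_eq_zero_of_notMem q ha]
    simpa using Matrix.rank_le_width _

theorem balancedOrbit_mem_orbitsMeeting {n r : ℕ} (hr : 0 < r) (q : MonicPoly n) :
    balancedOrbit r q ∈ orbitsMeeting n r := by
  obtain ⟨X, hX, h⟩ := exists_mem_subdiagonalSet_balancedOrbit hr q
  rw [← h]
  exact mem_orbitsMeeting_iff.2 ⟨X, hX, MatrixSimilar.refl X⟩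

/-- With exactly `r` slots per root, some of them empty, a balancing move can also create a new
block. -/
theorem jordanMatrix_similar_padded {n r : ℕ} (q : MonicPoly n) (L : JordanData q.1)
    (hL : ∀ a, (L a).parts.card ≤ r) :
    ∃ s : {a : ℂ // a ∈ q.1.roots.toFinset} × Fin r → ℕ,
      MatrixSimilar (jordanMatrix q L) (jordanSum (fun i => i.1.1) s) ∧
      ∀ a, (∑ i, if i.1.1 = a then s i else 0) = q.1.rootMultiplicity a := by
  have hlen : ∀ a, ((L a).parts.sort (· ≥ ·)).length ≤ r := fun a => by
    rw [Multiset.length_sort]; exact hL a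
  let s : {a : ℂ // a ∈ q.1.roots.toFinset} × Fin r → ℕ :=
    fun i => ((L i.1).parts.sort (· ≥ ·)).getD i.2 0
  let e : JordanBlockIndex L → {a : ℂ // a ∈ q.1.roots.toFinset} × Fin r :=
    fun b => (b.1, Fin.castLE (hlen b.1) b.2)
  have he : Function.Injective e := by
    rintro ⟨a, j⟩ ⟨a', j'⟩ h
    obtain rfl : a = a' := congrArg Prod.fst h
    have h2 : (j : ℕ) = j' := congrArg (fun x => (x.2 : ℕ)) h
    rw [Fin.ext h2]
  have hs : ∀ b, s (e b) = partAt (L b.1) b.2 := by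
    intro b
    exact List.getD_eq_getElem _ _ b.2.2
  have h0 : ∀ i, i ∉ Set.range e → s i = 0 := by
    rintro ⟨a, j⟩ hi
    apply List.getD_eq_default
    by_contra h
    exact hi ⟨⟨a, j, not_le.1 h⟩, rfl⟩
  refine ⟨s, (jordanMatrix_similar q L).trans
    (MatrixSimilar.jordanSum_of_injective e he (fun _ => rfl) hs h0), fun a => ?_⟩
  rw [← (L a).parts_sum, ← Multiset.map_id' (L a).parts, ← sum_jordanBlockIndex_ite L a fun p => p]
  refine (Fintype.sum_of_injective e he _ _ ?_ ?_).symm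
  · intro i hi
    simp [h0 i hi]
  · intro b
    rw [hs]

theorem balancedOrbit_closureLE {n r : ℕ} (hr : 0 < r) (q : MonicPoly n) (L : JordanData q.1)
    (hL : ∀ a, (L a).parts.card ≤ r) : (balancedOrbit r q).ClosureLE (jordanOrbit q L) := by
  classical
  obtain ⟨s, hs, hsum⟩ := jordanMatrix_similar_padded q L hL
  obtain ⟨s', X, hX, hle, hbal, hsum'⟩ := exists_closureLE_balanced s _ hs
  have hn : n = ∑ i, s' i := by simpa [Fintype.card_sigma] using hX.card_eq
  have hrank : ∀ (a : ℂ) (k : ℕ), ((X - a • (1 : Matrix (Fin n) (Fin n) ℂ)) ^ k).rank =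
      n - min (q.1.rootMultiplicity a) (r * k) := by
    intro a k
    set F := Finset.univ.filter
      fun i : {a : ℂ // a ∈ q.1.roots.toFinset} × Fin r => i.1.1 = a with hF
    have hm : q.1.rootMultiplicity a = ∑ i ∈ F, s' i := by
      rw [← hsum, ← hsum', hF, Finset.sum_filter]
    have h1 := sum_tsub_of_balanced F s' (fun i hi j hj => hbal i j (by
      rw [(Finset.mem_filter.1 hi).2, (Finset.mem_filter.1 hj).2])) k
    have h2 : (∑ i, if i.1.1 = a then s' i - k else s' i) + ∑ i ∈ F, s' i =
        n + ∑ i ∈ F, (s' i - k) := by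
      refine Eq.trans ?_ (congrArg (· + ∑ i ∈ F, (s' i - k)) hn.symm)
      rw [hF, Finset.sum_filter, Finset.sum_filter, ← Finset.sum_add_distrib,
        ← Finset.sum_add_distrib]
      refine Finset.sum_congr rfl fun i _ => ?_
      split_ifs <;> omega
    -- For `a` not a root, `F` need not have `r` elements, but its sum is zero.
    have h3 : ∑ i ∈ F, s' i - F.card * k = ∑ i ∈ F, s' i - r * k := by
      by_cases ha : a ∈ q.1.roots.toFinset
      · have : F.card = r := by
          have : F = {⟨a, ha⟩} ×ˢ Finset.univ := by
            ext ⟨b, j⟩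
            simp [hF, Subtype.ext_iff, eq_comm]
          rw [this, Finset.card_product, Finset.card_singleton, one_mul, Finset.card_univ,
            Fintype.card_fin]
        rw [this]
      · rw [← hm, rootMultiplicity_eq_zero_of_notMem q ha, Nat.zero_sub, Nat.zero_sub]
    have h4 := rootMultiplicity_le q a
    rw [hX.rank_sub_pow, rank_jordanSum_sub_pow]
    omega
  rw [← adjointOrbitOf_eq_balancedOrbit hr q (X := X) (fun a k => by rw [hrank]; omega)
    (fun a k => (hrank a k).le)]
  exact hle

theorem orbitFilter_subset_orbitsMeeting {n r : ℕ} (hr : 0 < r) :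
    orbitFilter n r ⊆ orbitsMeeting n r := by
  intro O hO
  obtain ⟨q, L, hL, rfl⟩ := Set.mem_iUnion.1 hO
  obtain ⟨X, hX, h⟩ := exists_mem_subdiagonalSet_balancedOrbit hr q
  have hle := balancedOrbit_closureLE hr q L hL
  rw [← h] at hle
  exact mem_orbitsMeeting_iff.2 (exists_mem_subdiagonalSet_of_closureLE hr hX hle)

theorem exists_jordanOrbit_eq {n : ℕ} (M : Matrix (Fin n) (Fin n) ℂ) :
    ∃ (q : MonicPoly n) (L : JordanData q.1), adjointOrbitOf M = jordanOrbit q L := by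
  classical
  obtain ⟨ι, _, _, d, s, hM⟩ := exists_similar_jordanSum M
  have hn : n = ∑ i, s i := by simpa [Fintype.card_sigma] using hM.card_eq
  let q : ℂ[X] := ∏ i, (X - C (d i)) ^ s i
  have hq : q.Monic := monic_prod_of_monic _ _ fun i _ => (monic_X_sub_C (d i)).pow _
  have hdeg : q.natDegree = n := by
    rw [natDegree_prod_of_monic _ _ fun i _ => (monic_X_sub_C (d i)).pow _, hn]
    simp
  have hroot : ∀ a, q.rootMultiplicity a = ∑ i, if d i = a then s i else 0 := by
    intro a
    rw [← count_roots, roots_prod _ _ hq.ne_zero, Multiset.count_bind]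
    simp only [roots_pow, roots_X_sub_C, Multiset.count_nsmul, Multiset.count_singleton]
    change (∑ i, _) = _
    refine Finset.sum_congr rfl fun i _ => ?_
    by_cases h : d i = a
    · simp [h]
    · simp [h, Ne.symm h]
  let L : JordanData q := fun a => Nat.Partition.ofSums _
    ((Finset.univ.filter fun i => d i = a).val.map s) (by
      rw [hroot, ← Finset.sum_filter]; rfl)
  refine ⟨⟨q, hq, hdeg⟩, L, adjointOrbitOf_eq_iff.2 (similar_of_rank_eq fun a k => ?_)⟩
  have h := rank_jordanMatrix_sub_pow ⟨q, hq, hdeg⟩ L a k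
  have hparts : ((L a).parts.map (· - k)).sum = ∑ i, if d i = a then s i - k else 0 := by
    change ((((Finset.univ.filter fun i => d i = a).val.map s).filter (· ≠ 0)).map
      (· - k)).sum = _
    rw [sum_map_tsub_filter_ne_zero, Multiset.map_map, ← Finset.sum_filter]
    rfl
  have h1 : (∑ i, if d i = a then s i - k else s i) + q.rootMultiplicity a =
      n + ((L a).parts.map (· - k)).sum := by
    rw [hparts, hroot, hn, ← Finset.sum_add_distrib, ← Finset.sum_add_distrib]
    refine Finset.sum_congr rfl fun i _ => ?_
    split_ifs <;> omega
  rw [hM.rank_sub_pow, rank_jordanSum_sub_pow]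
  simp only at h
  omega

theorem orbitsMeeting_subset_orbitFilter {n r : ℕ} (hr : 0 < r) :
    orbitsMeeting n r ⊆ orbitFilter n r := by
  intro O hO
  obtain ⟨X, rfl⟩ := exists_adjointOrbitOf_eq O
  obtain ⟨Z, hZ, hZX⟩ := mem_orbitsMeeting_iff.1 hO
  obtain ⟨q, L, hL⟩ := exists_jordanOrbit_eq X
  refine Set.mem_iUnion.2 ⟨q, L, fun a => ?_, hL⟩
  -- At `k = 1` the rank drop is the number of blocks with eigenvalue `a`, since all parts are
  -- positive (`h3`).
  have h1 := le_rank_sub_pow_of_mem_subdiagonalSet hr hZ a 1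
  rw [(hZX.trans (adjointOrbitOf_eq_iff.1 hL)).rank_sub_pow] at h1
  have h2 := rank_jordanMatrix_sub_pow q L a 1
  have h3 : ∀ t : Multiset ℕ, (∀ x ∈ t, 0 < x) → t.sum = (t.map (· - 1)).sum + t.card := by
    intro t
    induction t using Multiset.induction_on with
    | empty => simp
    | cons x t ih =>
      intro h
      have hx := h x (Multiset.mem_cons_self _ _)
      have := ih fun y hy => h y (Multiset.mem_cons_of_mem hy)
      simp only [Multiset.sum_cons, Multiset.map_cons, Multiset.card_cons]
      omega
  have h4 := h3 (L a).parts fun x hx => (L a).parts_pos hx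
  rw [(L a).parts_sum] at h4
  have h5 := rootMultiplicity_le q a
  omega

theorem theorem2p3 (n r : ℕ) (hr : 0 < r) :
    orbitsMeeting n r = orbitFilter n r ∧
      minimalOrbits (orbitsMeeting n r) =
        Set.range (fun q : MonicPoly n => balancedOrbit r q) := by
  have hEq : orbitsMeeting n r = orbitFilter n r :=
    (orbitsMeeting_subset_orbitFilter hr).antisymm (orbitFilter_subset_orbitsMeeting hr)
  refine ⟨hEq, Set.Subset.antisymm ?_ ?_⟩
  · rintro O ⟨hO, hmin⟩
    rw [hEq] at hO
    obtain ⟨q, L, hL, rfl⟩ := Set.mem_iUnion.1 hO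
    exact ⟨q, hmin _ (balancedOrbit_mem_orbitsMeeting hr q) (balancedOrbit_closureLE hr q L hL)⟩
  · rintro _ ⟨q, rfl⟩
    refine ⟨balancedOrbit_mem_orbitsMeeting hr q, fun O' hO' hle => ?_⟩
    obtain ⟨X, rfl⟩ := exists_adjointOrbitOf_eq O'
    obtain ⟨Z, hZ, hZX⟩ := mem_orbitsMeeting_iff.1 hO'
    refine adjointOrbitOf_eq_balancedOrbit hr q (fun a k => ?_) fun a k => ?_
    · rw [← hZX.rank_sub_pow]
      exact le_rank_sub_pow_of_mem_subdiagonalSet hr hZ a k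
    · rw [← rank_balanced_sub_pow hr]
      exact rank_sub_pow_le_of_closureLE hle a k
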